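/- Let $d\ge 3$ and let $c$ be the standard conformal structure on the unit sphere $\mathbb S^d\subset\mathbb R^{d+1}$, i.e. the set of all metrics $e^{2\omega}g_0$ with $g_0$ the round metric and $\omega\in C^\infty(\mathbb S^d)$. For $g\in c$ let $\nabla$ be its Levi-Civita connection, $\Delta=-\nabla^a\nabla_a$, $P$ its Schouten tensor ($\mathrm{Ric}=(d-2)P+Jg$, $J=\mathrm{tr}_gP$). A density $\sigma\in\mathcal E[w]$ is a family of smooth functions $(\sigma_g)_{g\in c}$ with $\sigma_{e^{2\omega}g}=e^{w\omega}\sigma_g$. A directed almost Einstein structure compatible with $c$ is a density $\sigma\in\mathcal E[1]$, $\sigma\neq0$, such that, with $s=\sigma_g$, $$\text{trace-free part of }(\nabla\nabla s+sP)=0\quad\text{for every } g\in c;$$ put $S(\sigma)=\frac2d s(J-\Delta)s-|ds|_g^2$ (which does not depend on $g\in c$). A section of the standard tractor bundle $\mathcal T$ (of rank $d+2$) is a family, indexed by $g\in c$, of triples $(\sigma,\mu,\rho)$ of a smooth function, a smooth 1-form and a smooth function, subject to $$(\sigma,\mu,\rho)\mapsto\bigl(e^{\omega}\sigma,\ e^{\omega}(\mu+\sigma\,d\omega),\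 e^{-\omega}(\rho-g^{-1}(d\omega,\mu)-\tfrac12\sigma|d\omega|_g^2)\bigr)$$ when $g$ is replaced by $e^{2\omega}g$; the normal tractor connection is $$\nabla_a(\sigma,\mu_b,\rho)=(\nabla_a\sigma-\mu_a,\ \nabla_a\mu_b+g_{ab}\rho+P_{ab}\sigma,\ \nabla_a\rho-P_{ab}\mu^b).$$ For a section $I=(\sigma,\mu,\rho)$ of $\mathcal T$ write $h(X,I)=\sigma\in\mathcal E[1]$ (the pairing, by the tractor metric $h(I,I)=g^{-1}(\mu,\mu)+2\sigma\rho$, with the canonical tractor $X=(0,0,1)$) and $S(I)=S(\sigma)$. Then: 1. The tractor connection on $\mathbb S^d$ is flat, and globally trivial: every element of every fibre of $\mathcal T$ is the value of exactly one global parallel section. Moreover $I\mapsto h(X,I)$ is a bijection from the nonzero parallel sections of $\mathcal T$ onto the directed almost Einstein structures compatible with $c$. 2. The directed almost Einstein structures compatible with $c$ are precisely the nonzero elements of a $(d+2)$-dimensional linear subspace of $\mathcal E[1]$. 3. For every $S\in\mathbb R$ there is an almost Einstein structure $I$ on $\mathbb S^d$, that is, a nonzero parallel section of $\mathcal T$ for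 which $h(X,I)$ is a directed almost Einstein structure, with $S(I)=S$ (a constant function). -/

import Mathlib

open Manifold Bundle
open scoped ContDiff

noncomputable section

/-! ## Smooth Riemannian metrics and conformal classes -/

/-- Smooth Riemannian metrics on a smooth `d`-manifold `M` without boundary. -/
abbrev SmoothMetric (d : ℕ) (M : Type*) [TopologicalSpace M]
    [ChartedSpace (EuclideanSpace ℝ (Fin d)) M] [IsManifold (𝓡 d) ∞ M] : Type _ :=
  ContMDiffRiemannianMetric (𝓡 d) ∞ (EuclideanSpace ℝ (Fin d))
    (fun x : M => TangentSpace (𝓡 d) x)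

/-- Smooth real-valued functions on `M`. -/
abbrev SmoothFn (d : ℕ) (M : Type*) [TopologicalSpace M]
    [ChartedSpace (EuclideanSpace ℝ (Fin d)) M] : Type _ :=
  C^∞⟮𝓡 d, M; 𝓘(ℝ, ℝ), ℝ⟯

/-- Smooth 1-forms on `M`, that is, smooth sections of the cotangent bundle. -/
abbrev OneForm (d : ℕ) (M : Type*) [TopologicalSpace M]
    [ChartedSpace (EuclideanSpace ℝ (Fin d)) M] [IsManifold (𝓡 d) ∞ M] : Type _ :=
  Cₛ^∞⟮𝓡 d; EuclideanSpace ℝ (Fin d) →L[ℝ] ℝ,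
    fun x : M => TangentSpace (𝓡 d) x →L[ℝ] Bundle.Trivial M ℝ x⟯

section Conformal

variable {d : ℕ} {M : Type*} [TopologicalSpace M]
  [ChartedSpace (EuclideanSpace ℝ (Fin d)) M] [IsManifold (𝓡 d) ∞ M]

/-- `g' = e^{2φ} g`. -/
def IsRescaling (g g' : SmoothMetric d M) (φ : SmoothFn d M) : Prop :=
  ∀ (x : M) (v w : TangentSpace (𝓡 d) x),
    g'.inner x v w = Real.exp (2 * φ x) * g.inner x v w

/-- The conformal class of a metric. -/
def conformalClass (g₀ : SmoothMetric d M) : Set (SmoothMetric d M) :=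
  {g | ∃ φ : SmoothFn d M, IsRescaling g₀ g φ}

/-! ## Levi-Civita calculus in a chart

All quantities below are the usual coordinate expressions, in the chart `e`, at the point
`y ∈ e.target`. -/

/-- The coordinate vector `∂_i` of the model space. -/
def stdVec (d : ℕ) (i : Fin d) : EuclideanSpace ℝ (Fin d) := EuclideanSpace.single i 1

/-- The partial derivative `∂_i f` of a function of the coordinates. -/
def pderiv {d : ℕ} (i : Fin d) (f : EuclideanSpace ℝ (Fin d) → ℝ)
    (y : EuclideanSpace ℝ (Fin d)) : ℝ :=
  fderiv ℝ f y (stdVec d i)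

/-- The `i`-th coordinate vector field of the chart `e`, at the point with coordinates `y`. -/
def coordVec (e : OpenPartialHomeomorph M (EuclideanSpace ℝ (Fin d)))
    (y : EuclideanSpace ℝ (Fin d)) (i : Fin d) : TangentSpace (𝓡 d) (e.symm y) :=
  mfderiv (𝓡 d) (𝓡 d) e.symm y (stdVec d i)

/-- The coordinate expression of a function. -/
def fnCoord (e : OpenPartialHomeomorph M (EuclideanSpace ℝ (Fin d))) (f : SmoothFn d M)
    (y : EuclideanSpace ℝ (Fin d)) : ℝ :=
  f (e.symm y)

/-- The components `μ_j` of a 1-form. -/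
def formCoord (e : OpenPartialHomeomorph M (EuclideanSpace ℝ (Fin d))) (μ : OneForm d M)
    (y : EuclideanSpace ℝ (Fin d)) (j : Fin d) : ℝ :=
  μ (e.symm y) (coordVec e y j)

/-- The components `g_{ij}` of a metric. -/
def gCoord (g : SmoothMetric d M) (e : OpenPartialHomeomorph M (EuclideanSpace ℝ (Fin d)))
    (y : EuclideanSpace ℝ (Fin d)) : Matrix (Fin d) (Fin d) ℝ :=
  Matrix.of fun i j => g.inner (e.symm y) (coordVec e y i) (coordVec e y j)

/-- The components `g^{ij}` of the inverse metric. -/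
def gInv (g : SmoothMetric d M) (e : OpenPartialHomeomorph M (EuclideanSpace ℝ (Fin d)))
    (y : EuclideanSpace ℝ (Fin d)) : Matrix (Fin d) (Fin d) ℝ :=
  (gCoord g e y)⁻¹

/-- The Christoffel symbols `Γ^k_{ij}` of the Levi-Civita connection. -/
def christoffel (g : SmoothMetric d M) (e : OpenPartialHomeomorph M (EuclideanSpace ℝ (Fin d)))
    (k i j : Fin d) (y : EuclideanSpace ℝ (Fin d)) : ℝ :=
  (1 / 2) * ∑ l, gInv g e y k l *
    (pderiv i (fun z => gCoord g e z j l) y + pderiv j (fun z => gCoord g e z i l) y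
      - pderiv l (fun z => gCoord g e z i j) y)

/-- The Ricci tensor
`Ric_{ij} = ∂_k Γ^k_{ij} - ∂_i Γ^k_{kj} + Γ^k_{km} Γ^m_{ij} - Γ^k_{im} Γ^m_{kj}`. -/
def ricci (g : SmoothMetric d M) (e : OpenPartialHomeomorph M (EuclideanSpace ℝ (Fin d)))
    (y : EuclideanSpace ℝ (Fin d)) (i j : Fin d) : ℝ :=
  ∑ k, (pderiv k (christoffel g e k i j) y - pderiv i (christoffel g e k k j) y
    + ∑ m, (christoffel g e k k m y * christoffel g e m i j y
      - christoffel g e k i m y * christoffel g e m k j y))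

/-- The metric trace `g^{ij} B_{ij}` of a bilinear form. -/
def gTrace (g : SmoothMetric d M) (e : OpenPartialHomeomorph M (EuclideanSpace ℝ (Fin d)))
    (y : EuclideanSpace ℝ (Fin d)) (B : Fin d → Fin d → ℝ) : ℝ :=
  ∑ i, ∑ j, gInv g e y i j * B i j

/-- The metric pairing `g^{ij} α_i β_j` of two covectors. -/
def coInner (g : SmoothMetric d M) (e : OpenPartialHomeomorph M (EuclideanSpace ℝ (Fin d)))
    (y : EuclideanSpace ℝ (Fin d)) (α β : Fin d → ℝ) : ℝ :=
  ∑ i, ∑ j, gInv g e y i j * α i * β j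

/-- The Schouten tensor `P`, solved from `Ric = (d - 2) P + J g`, `J = g^{ij} P_{ij}`:
`P = (Ric - Sc / (2 (d - 1)) g) / (d - 2)` (for `d ≥ 3`). -/
def schouten (g : SmoothMetric d M) (e : OpenPartialHomeomorph M (EuclideanSpace ℝ (Fin d)))
    (y : EuclideanSpace ℝ (Fin d)) (i j : Fin d) : ℝ :=
  (ricci g e y i j - gTrace g e y (ricci g e y) / (2 * ((d : ℝ) - 1)) * gCoord g e y i j)
    / ((d : ℝ) - 2)

/-- `J`, the metric trace of the Schouten tensor. -/
def schoutenTrace (g : SmoothMetric d M)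
    (e : OpenPartialHomeomorph M (EuclideanSpace ℝ (Fin d)))
    (y : EuclideanSpace ℝ (Fin d)) : ℝ :=
  gTrace g e y (schouten g e y)

/-- The Hessian `∇_i ∇_j s = ∂_i ∂_j s - Γ^k_{ij} ∂_k s`. -/
def hessian (g : SmoothMetric d M) (e : OpenPartialHomeomorph M (EuclideanSpace ℝ (Fin d)))
    (s : SmoothFn d M) (y : EuclideanSpace ℝ (Fin d)) (i j : Fin d) : ℝ :=
  pderiv i (pderiv j (fnCoord e s)) y
    - ∑ k, christoffel g e k i j y * pderiv k (fnCoord e s) y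

/-- `A(g,s)`, the trace-free part of `∇∇s + s P`. -/
def aeTensor (g : SmoothMetric d M) (e : OpenPartialHomeomorph M (EuclideanSpace ℝ (Fin d)))
    (s : SmoothFn d M) (y : EuclideanSpace ℝ (Fin d)) (i j : Fin d) : ℝ :=
  let B : Fin d → Fin d → ℝ := fun k l => hessian g e s y k l + fnCoord e s y * schouten g e y k l
  B i j - gTrace g e y B / (d : ℝ) * gCoord g e y i j

/-- `S(g,s) = (2/d) s (J - Δ) s - |ds|²`, where `Δ = -∇^a ∇_a`. -/
def scaleCurv (g : SmoothMetric d M) (e : OpenPartialHomeomorph M (EuclideanSpace ℝ (Fin d)))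
    (s : SmoothFn d M) (y : EuclideanSpace ℝ (Fin d)) : ℝ :=
  (2 / (d : ℝ)) * fnCoord e s y *
      (schoutenTrace g e y * fnCoord e s y + gTrace g e y (hessian g e s y))
    - coInner g e y (fun i => pderiv i (fnCoord e s) y) (fun i => pderiv i (fnCoord e s) y)

/-! ## Conformal densities and almost Einstein structures -/

/-- Smooth sections of the density bundle `𝓔[w]` of a conformal class `c`: each metric `g ∈ c`
trivialises the bundle, turning the section into a function `f_g`, and
`f_{e^{2φ} g} = e^{wφ} f_g`. -/
def densities (c : Set (SmoothMetric d M)) (w : ℝ) : Submodule ℝ (c → SmoothFn d M) where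
  carrier := {f | ∀ (g g' : c) (φ : SmoothFn d M), IsRescaling (g : SmoothMetric d M) g' φ →
    ∀ x, f g' x = Real.exp (w * φ x) * f g x}
  add_mem' := by
    intro a b ha hb g g' φ h x
    have h1 := ha g g' φ h x
    have h2 := hb g g' φ h x
    simp only [Pi.add_apply, ContMDiffMap.coe_add, h1, h2]
    ring
  zero_mem' := by
    intro g g' φ h x
    simp
  smul_mem' := by
    intro r a ha g g' φ h x
    have h1 := ha g g' φ h x
    simp only [Pi.smul_apply, ContMDiffMap.coe_smul, smul_eq_mul, h1]
    ring

/-- `σ ∈ 𝓔[1]` solves the almost Einstein equation `A([g],σ) = 0`. -/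
def SolvesAE (c : Set (SmoothMetric d M)) (σ : densities c 1) : Prop :=
  ∀ g : c, ∀ e ∈ atlas (EuclideanSpace ℝ (Fin d)) M, ∀ y ∈ e.target, ∀ i j,
    aeTensor (g : SmoothMetric d M) e (σ.1 g) y i j = 0

/-- A directed almost Einstein structure compatible with the conformal class `c`: a non-trivial
solution of the almost Einstein equation. -/
def IsDirectedAE (c : Set (SmoothMetric d M)) (σ : densities c 1) : Prop :=
  SolvesAE c σ ∧ σ ≠ 0

/-- `S([g],σ)` is the constant function `S`. -/
def HasScaleCurv (c : Set (SmoothMetric d M)) (σ : densities c 1) (S : ℝ) : Prop :=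
  ∀ g : c, ∀ e ∈ atlas (EuclideanSpace ℝ (Fin d)) M, ∀ y ∈ e.target,
    scaleCurv (g : SmoothMetric d M) e (σ.1 g) y = S

/-! ## The standard tractor bundle and its connection -/

/-- Smooth sections of the standard tractor bundle of a conformal class `c`. A metric `g ∈ c`
splits the bundle as `𝓔[1] ⊕ T*M[1] ⊕ 𝓔[-1]` and trivialises the densities, so a section is given
by a triple `(σ, μ, ρ)` for each `g ∈ c`; the triples for `g` and `e^{2φ} g` are related by
`(σ, μ, ρ) ↦ (e^φ σ, e^φ (μ + σ dφ), e^{-φ} (ρ - g⁻¹(dφ, μ) - σ |dφ|² / 2))`. -/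
def tractors (c : Set (SmoothMetric d M)) :
    Submodule ℝ (c → SmoothFn d M × OneForm d M × SmoothFn d M) where
  carrier := {t | ∀ (g g' : c) (φ : SmoothFn d M), IsRescaling (g : SmoothMetric d M) g' φ →
    (∀ x, (t g').1 x = Real.exp (φ x) * (t g).1 x) ∧
    ∀ e ∈ atlas (EuclideanSpace ℝ (Fin d)) M, ∀ y ∈ e.target,
      (∀ j, formCoord e (t g').2.1 y j = Real.exp (fnCoord e φ y) *
        (formCoord e (t g).2.1 y j + fnCoord e (t g).1 y * pderiv j (fnCoord e φ) y)) ∧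
      fnCoord e (t g').2.2 y = Real.exp (-fnCoord e φ y) *
        (fnCoord e (t g).2.2 y
          - coInner (g : SmoothMetric d M) e y (fun i => pderiv i (fnCoord e φ) y)
              (formCoord e (t g).2.1 y)
          - (1 / 2) * fnCoord e (t g).1 y *
            coInner (g : SmoothMetric d M) e y (fun i => pderiv i (fnCoord e φ) y)
              (fun i => pderiv i (fnCoord e φ) y))}
  add_mem' := by
    intro a b ha hb g g' φ h
    obtain ⟨ha1, ha2⟩ := ha g g' φ h
    obtain ⟨hb1, hb2⟩ := hb g g' φ h
    have hf : ∀ (e : OpenPartialHomeomorph M (EuclideanSpace ℝ (Fin d))) (p q : SmoothFn d M)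
        (y : EuclideanSpace ℝ (Fin d)), fnCoord e (p + q) y = fnCoord e p y + fnCoord e q y :=
      fun _ _ _ _ => rfl
    have hm : ∀ (e : OpenPartialHomeomorph M (EuclideanSpace ℝ (Fin d))) (p q : OneForm d M)
        (y : EuclideanSpace ℝ (Fin d)) (j : Fin d),
        formCoord e (p + q) y j = formCoord e p y j + formCoord e q y j :=
      fun _ _ _ _ _ => rfl
    refine ⟨fun x => ?_, fun e he y hy => ⟨fun j => ?_, ?_⟩⟩
    · simp only [Pi.add_apply, Prod.fst_add, ContMDiffMap.coe_add, ha1, hb1]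
      ring
    · simp only [Pi.add_apply, Prod.fst_add, Prod.snd_add, hf, hm, (ha2 e he y hy).1,
        (hb2 e he y hy).1]
      ring
    · have hc : ∀ (k : SmoothMetric d M) (α β γ : Fin d → ℝ), coInner k e y α (fun j => β j + γ j)
          = coInner k e y α β + coInner k e y α γ := by
        intro k α β γ
        simp only [coInner, mul_add, Finset.sum_add_distrib]
      have hm' : formCoord e ((a g).2.1 + (b g).2.1) y
          = fun j => formCoord e (a g).2.1 y j + formCoord e (b g).2.1 y j := rfl
      simp only [Pi.add_apply, Prod.fst_add, Prod.snd_add, hf, hm', hc, (ha2 e he y hy).2,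
        (hb2 e he y hy).2]
      ring
  zero_mem' := by
    intro g g' φ h
    have hf : ∀ (e : OpenPartialHomeomorph M (EuclideanSpace ℝ (Fin d)))
        (y : EuclideanSpace ℝ (Fin d)), fnCoord e (0 : SmoothFn d M) y = 0 := fun _ _ => rfl
    have hm : ∀ (e : OpenPartialHomeomorph M (EuclideanSpace ℝ (Fin d)))
        (y : EuclideanSpace ℝ (Fin d)) (j : Fin d), formCoord e (0 : OneForm d M) y j = 0 :=
      fun _ _ _ => rfl
    refine ⟨fun x => ?_, fun e he y hy => ⟨fun j => ?_, ?_⟩⟩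
    · simp
    · simp [hf, hm]
    · simp [hf, hm, coInner]
  smul_mem' := by
    intro r a ha g g' φ h
    obtain ⟨ha1, ha2⟩ := ha g g' φ h
    have hf : ∀ (e : OpenPartialHomeomorph M (EuclideanSpace ℝ (Fin d))) (p : SmoothFn d M)
        (y : EuclideanSpace ℝ (Fin d)), fnCoord e (r • p) y = r * fnCoord e p y :=
      fun _ _ _ => rfl
    have hm : ∀ (e : OpenPartialHomeomorph M (EuclideanSpace ℝ (Fin d))) (p : OneForm d M)
        (y : EuclideanSpace ℝ (Fin d)) (j : Fin d),
        formCoord e (r • p) y j = r * formCoord e p y j :=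
      fun _ _ _ _ => rfl
    refine ⟨fun x => ?_, fun e he y hy => ⟨fun j => ?_, ?_⟩⟩
    · simp only [Pi.smul_apply, Prod.smul_fst, ContMDiffMap.coe_smul, smul_eq_mul, ha1]
      ring
    · simp only [Pi.smul_apply, Prod.smul_fst, Prod.smul_snd, hf, hm, (ha2 e he y hy).1]
      ring
    · have hc : ∀ (k : SmoothMetric d M) (α β : Fin d → ℝ), coInner k e y α (fun j => r * β j)
          = r * coInner k e y α β := by
        intro k α β
        simp only [coInner, Finset.mul_sum]
        exact Finset.sum_congr rfl fun i _ => Finset.sum_congr rfl fun j _ => by ring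
      have hm' : formCoord e (r • (a g).2.1) y = fun j => r * formCoord e (a g).2.1 y j := rfl
      simp only [Pi.smul_apply, Prod.smul_fst, Prod.smul_snd, hf, hm', hc, (ha2 e he y hy).2]
      ring

/-- The density `σ = h(X, I) ∈ 𝓔[1]` of a standard tractor `I = (σ, μ, ρ)`, where `h` is the
tractor metric `(σ, μ, ρ) ↦ g⁻¹(μ, μ) + 2 σ ρ` and `X = (0, 0, 1)` is the canonical tractor. -/
def tractorScale (c : Set (SmoothMetric d M)) (I : tractors c) : densities c 1 :=
  ⟨fun g => (I.1 g).1, fun g g' φ h x => by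
    rw [one_mul]
    exact (I.2 g g' φ h).1 x⟩

/-- A triple `(σ, μ_j, ρ)` of component functions: a local section of the tractor bundle over a
chart domain, in the splitting given by a metric and the coordinate frame. -/
abbrev LocalTractor (d : ℕ) : Type :=
  EuclideanSpace ℝ (Fin d) → ℝ × (Fin d → ℝ) × ℝ

/-- The normal tractor connection in the direction `∂_i`:
`∇_i (σ, μ_j, ρ) = (∇_i σ - μ_i, ∇_i μ_j + g_{ij} ρ + P_{ij} σ, ∇_i ρ - P_{ij} μ^j)`. -/
def tractorDeriv (g : SmoothMetric d M) (e : OpenPartialHomeomorph M (EuclideanSpace ℝ (Fin d)))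
    (i : Fin d) (t : LocalTractor d) : LocalTractor d := fun y =>
  (pderiv i (fun z => (t z).1) y - (t y).2.1 i,
   fun j => pderiv i (fun z => (t z).2.1 j) y - ∑ k, christoffel g e k i j y * (t y).2.1 k
      + gCoord g e y i j * (t y).2.2 + schouten g e y i j * (t y).1,
   pderiv i (fun z => (t z).2.2) y - coInner g e y (schouten g e y i) (t y).2.1)

/-- The component functions of a global triple. -/
def tractorCoord (e : OpenPartialHomeomorph M (EuclideanSpace ℝ (Fin d)))
    (t : SmoothFn d M × OneForm d M × SmoothFn d M) : LocalTractor d := fun y =>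
  (fnCoord e t.1 y, formCoord e t.2.1 y, fnCoord e t.2.2 y)

/-- `I` is parallel for the tractor connection. -/
def IsParallelTractor (c : Set (SmoothMetric d M)) (I : tractors c) : Prop :=
  ∀ g : c, ∀ e ∈ atlas (EuclideanSpace ℝ (Fin d)) M, ∀ y ∈ e.target, ∀ i,
    tractorDeriv (g : SmoothMetric d M) e i (tractorCoord e (I.1 g)) y = 0

/-- The curvature `∇_i ∇_j - ∇_j ∇_i` of the tractor connection vanishes. -/
def TractorFlat (c : Set (SmoothMetric d M)) : Prop :=
  ∀ g ∈ c, ∀ e ∈ atlas (EuclideanSpace ℝ (Fin d)) M, ∀ t : LocalTractor d,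
    ContDiffOn ℝ ∞ t e.target → ∀ y ∈ e.target, ∀ i j,
      tractorDeriv g e i (tractorDeriv g e j t) y = tractorDeriv g e j (tractorDeriv g e i t) y

/-- The tractor bundle with its connection is globally trivial: every element of the fibre over
every point is the value of exactly one globally defined parallel section. -/
def TractorTrivial (c : Set (SmoothMetric d M)) : Prop :=
  ∀ (g : c) (p : M) (s₀ : ℝ) (μ₀ : TangentSpace (𝓡 d) p →L[ℝ] ℝ) (r₀ : ℝ),
    ∃! I : tractors c, IsParallelTractor c I ∧
      (I.1 g).1 p = s₀ ∧ (∀ v, (I.1 g).2.1 p v = μ₀ v) ∧ (I.1 g).2.2 p = r₀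

end Conformal

/-! ## The round sphere -/

/-- The unit sphere in `ℝ^{d+1}`. -/
abbrev USphere (d : ℕ) : Type := Metric.sphere (0 : EuclideanSpace ℝ (Fin (d + 1))) 1

/-- The differential of the inclusion of the sphere in `ℝ^{d+1}`. -/
def sphereIncl (d : ℕ) (x : USphere d) :
    TangentSpace (𝓡 d) x →L[ℝ] EuclideanSpace ℝ (Fin (d + 1)) :=
  mfderiv (𝓡 d) 𝓘(ℝ, EuclideanSpace ℝ (Fin (d + 1)))
    (fun p : USphere d => (p : EuclideanSpace ℝ (Fin (d + 1)))) x

theorem sphereIncl_injective (d : ℕ) (x : USphere d) : Function.Injective (sphereIncl d x) := by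
  have := Fact.mk (@finrank_euclideanSpace_fin ℝ _ (d + 1))
  exact injective_mvfderiv_subtypeVal_sphere (E := EuclideanSpace ℝ (Fin (d + 1))) (n := d) x

/-- The Euclidean inner product pulled back along a linear map. -/
def pullInner (d : ℕ)
    (A : EuclideanSpace ℝ (Fin d) →L[ℝ] EuclideanSpace ℝ (Fin (d + 1))) :
    EuclideanSpace ℝ (Fin d) →L[ℝ] EuclideanSpace ℝ (Fin d) →L[ℝ] ℝ :=
  (innerSL ℝ (E := EuclideanSpace ℝ (Fin (d + 1)))).bilinearComp A A

/-- The inner product that the tangent spaces of the sphere inherit from `ℝ^{d+1}`. -/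
def roundInner (d : ℕ) (x : USphere d) :
    TangentSpace (𝓡 d) x →L[ℝ] TangentSpace (𝓡 d) x →L[ℝ] ℝ :=
  pullInner d (sphereIncl d x)

theorem roundInner_apply (d : ℕ) (x : USphere d) (v w : TangentSpace (𝓡 d) x) :
    roundInner d x v w = inner ℝ (sphereIncl d x v) (sphereIncl d x w) := rfl

theorem roundInner_isVonNBounded (d : ℕ) (x : USphere d) :
    Bornology.IsVonNBounded ℝ {v : TangentSpace (𝓡 d) x | roundInner d x v v < 1} := by
  let A : EuclideanSpace ℝ (Fin d) →L[ℝ] EuclideanSpace ℝ (Fin (d + 1)) := sphereIncl d x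
  have hA : Function.Injective A := sphereIncl_injective d x
  change Bornology.IsVonNBounded ℝ {v : EuclideanSpace ℝ (Fin d) | inner ℝ (A v) (A v) < 1}
  obtain ⟨K, hK, hlip⟩ := A.toLinearMap.exists_antilipschitzWith (LinearMap.ker_eq_bot.2 hA)
  refine (NormedSpace.isVonNBounded_ball ℝ (EuclideanSpace ℝ (Fin d)) (K * 1 + 1)).subset ?_
  intro v hv
  have h1 : ‖A v‖ < 1 := by
    have : ‖A v‖ ^ 2 < 1 := by
      rw [← real_inner_self_eq_norm_sq]; exact hv
    nlinarith [norm_nonneg (A v)]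
  have h2 := hlip.le_mul_dist v 0
  simp only [dist_zero_right, map_zero, ContinuousLinearMap.coe_coe] at h2
  have h3 : (K : ℝ) * ‖A v‖ ≤ K * 1 := mul_le_mul_of_nonneg_left h1.le K.2
  rw [mem_ball_zero_iff]
  linarith

theorem roundInner_contMDiff (d : ℕ) :
    ContMDiff (𝓡 d) ((𝓡 d).prod 𝓘(ℝ, EuclideanSpace ℝ (Fin d) →L[ℝ] EuclideanSpace ℝ (Fin d) →L[ℝ] ℝ)) ∞
      (fun x : USphere d => TotalSpace.mk' (EuclideanSpace ℝ (Fin d) →L[ℝ]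
        EuclideanSpace ℝ (Fin d) →L[ℝ] ℝ)
        (E := fun x : USphere d => TangentSpace (𝓡 d) x →L[ℝ] TangentSpace (𝓡 d) x →L[ℝ] ℝ)
        x (roundInner d x)) := by
  have := Fact.mk (@finrank_euclideanSpace_fin ℝ _ (d + 1))
  intro x
  rw [contMDiffAt_section]
  have hc : ContMDiff (𝓡 d) 𝓘(ℝ, EuclideanSpace ℝ (Fin (d + 1))) ∞
      (fun p : USphere d => (p : EuclideanSpace ℝ (Fin (d + 1)))) := contMDiff_coe_sphere
  have h1 := (hc x).mfderiv_const (m := ∞) (by simp)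
  let B : (EuclideanSpace ℝ (Fin d) →L[ℝ] EuclideanSpace ℝ (Fin (d+1))) →
      (EuclideanSpace ℝ (Fin d) →L[ℝ] EuclideanSpace ℝ (Fin d) →L[ℝ] ℝ) := fun A =>
      (innerSL ℝ (E := EuclideanSpace ℝ (Fin (d + 1)))).bilinearComp A A
  have hB : ContDiff ℝ ∞ B := by
    have : B = fun A => ((ContinuousLinearMap.compL ℝ (EuclideanSpace ℝ (Fin d)) (EuclideanSpace ℝ (Fin (d+1))) ℝ).flip A).comp ((innerSL ℝ (E := EuclideanSpace ℝ (Fin (d + 1)))).comp A) := by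
      ext A v w; rfl
    rw [this]
    fun_prop
  have h2 := hB.contMDiff.contMDiffAt.comp x h1
  have hx : ∀ᶠ y in nhds x, y ∈ (trivializationAt (EuclideanSpace ℝ (Fin d))
      (fun p : USphere d => TangentSpace (𝓡 d) p) x).baseSet :=
    (trivializationAt (EuclideanSpace ℝ (Fin d))
      (fun p : USphere d => TangentSpace (𝓡 d) p) x).open_baseSet.mem_nhds
      (FiberBundle.mem_baseSet_trivializationAt' x)
  refine h2.congr_of_eventuallyEq (hx.mono fun y hy => ?_)
  ext v w
  have key := inCoordinates_apply_eq₂ (𝕜 := ℝ) (F₁ := EuclideanSpace ℝ (Fin d))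
    (F₂ := EuclideanSpace ℝ (Fin d)) (F₃ := ℝ) (E₁ := fun p : USphere d => TangentSpace (𝓡 d) p)
    (E₂ := fun p : USphere d => TangentSpace (𝓡 d) p) (E₃ := Bundle.Trivial (USphere d) ℝ)
    (x₀ := x) (x := y) (ϕ := roundInner d y) (v := v) (w := w) hy hy (Set.mem_univ _)
  refine Eq.trans key ?_
  have h3 : ∀ u : EuclideanSpace ℝ (Fin d), inTangentCoordinates (𝓡 d)
      𝓘(ℝ, EuclideanSpace ℝ (Fin (d + 1))) id
      (fun p : USphere d => (p : EuclideanSpace ℝ (Fin (d + 1))))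
      (mfderiv (𝓡 d) 𝓘(ℝ, EuclideanSpace ℝ (Fin (d + 1)))
        (fun p : USphere d => (p : EuclideanSpace ℝ (Fin (d + 1))))) x y u =
      sphereIncl d y ((trivializationAt (EuclideanSpace ℝ (Fin d))
        (fun p : USphere d => TangentSpace (𝓡 d) p) x).symm y u) := by
    intro u
    simp only [ContinuousLinearMap.inCoordinates, inTangentCoordinates, id,
      TangentBundle.continuousLinearMapAt_model_space]
    change sphereIncl d y (Bundle.Trivialization.symmL ℝ _ y u) = _
    rw [Bundle.Trivialization.symmL_apply]
    exact hy
  have h4 : ∀ (A : EuclideanSpace ℝ (Fin d) →L[ℝ] EuclideanSpace ℝ (Fin (d + 1))),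
      B A v w = inner ℝ (A v) (A w) := fun A => rfl
  rw [Function.comp_apply, h4, h3, h3]
  simp [roundInner_apply]

/-- The round metric of the unit sphere. -/
def roundMetric (d : ℕ) : SmoothMetric d (USphere d) where
  inner := roundInner d
  symm x v w := real_inner_comm (sphereIncl d x w) (sphereIncl d x v)
  pos x v hv := by
    refine (real_inner_self_pos (x := sphereIncl d x v)).2 fun h => hv ?_
    exact sphereIncl_injective d x (h.trans (map_zero _).symm)
  isVonNBounded := roundInner_isVonNBounded d
  contMDiff := roundInner_contMDiff d

/-- The standard conformal structure of the `d`-sphere. -/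
def sphereConformal (d : ℕ) : Set (SmoothMetric d (USphere d)) :=
  conformalClass (roundMetric d)

end

/-! ## Partial derivatives -/

section PartialDerivatives

variable {d : ℕ} {f g : EuclideanSpace ℝ (Fin d) → ℝ} {y : EuclideanSpace ℝ (Fin d)}

/-! Everything is reduced to the flat tractor calculus of Euclidean space. In each stereographic
chart, whose target is all of `ℝ^d`, every metric of the standard conformal class has the form
`e^{2ψ} δ`. For such a metric the Christoffel symbols and the Schouten tensor are explicit in `ψ`. A
direct computation (`tractorDeriv_gauge`) shows that the change of splitting `tractorGauge ψ`
intertwines the Euclidean tractor connection `flatDeriv` with that of `e^{2ψ} δ`. Flatness is then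
the symmetry of second partial derivatives.

The same intertwining identifies `∇∇s + sP`, up to a multiple of the metric, with `e^ψ ∂∂u` where `s
= e^ψ u` (`aeTensor_eq`). So `s` is almost Einstein in the chart exactly when `∂∂u` is pure trace.
Since `d ≥ 2`, this forces `u` to be a quadratic polynomial `a + β·y - (ρ/2)|y|²`
(`eq_quadTractor_fst`), the top slot of a parallel section of the flat connection.

On the sphere these polynomials become the functions `c + ⟨b, x⟩`, with `c` real and `b` in
`ℝ^{d+1}`, in the round scale. Each gives a globally defined parallel tractor (`einsteinTractor`).
Conversely, a solution agrees with one of them in a single chart, hence everywhere, because the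
chart misses only one point and that point is not isolated. This gives the `(d+2)`-dimensional
solution space. A parallel tractor is determined by its top slot: the first two slots of the
parallel equation recover `μ` and `ρ`. Hence the bijection, and also that every parallel tractor is
an `einsteinTractor`. Triviality follows, since evaluation of these at a point is bijective onto the
fibre.

Finally, for a parallel tractor `S = -h(I, I)`, which here is the Lorentzian form `c² - |b|²`. This
takes every real value on nonzero pairs. -/

theorem pderiv_add (i : Fin d) (hf : DifferentiableAt ℝ f y) (hg : DifferentiableAt ℝ g y) :
    pderiv i (fun z => f z + g z) y = pderiv i f y + pderiv i g y := by
  simp [pderiv, fderiv_fun_add hf hg]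

theorem pderiv_sub (i : Fin d) (hf : DifferentiableAt ℝ f y) (hg : DifferentiableAt ℝ g y) :
    pderiv i (fun z => f z - g z) y = pderiv i f y - pderiv i g y := by
  simp [pderiv, fderiv_fun_sub hf hg]

theorem pderiv_neg (i : Fin d) : pderiv i (fun z => -f z) y = -pderiv i f y := by
  simp [pderiv, fderiv_fun_neg]

theorem pderiv_mul (i : Fin d) (hf : DifferentiableAt ℝ f y) (hg : DifferentiableAt ℝ g y) :
    pderiv i (fun z => f z * g z) y = pderiv i f y * g y + f y * pderiv i g y := by
  simp [pderiv, fderiv_fun_mul hf hg]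
  ring

theorem pderiv_const (i : Fin d) (r : ℝ) : pderiv i (fun _ => r) y = 0 := by
  simp [pderiv]

theorem pderiv_const_mul (i : Fin d) (r : ℝ) (hf : DifferentiableAt ℝ f y) :
    pderiv i (fun z => r * f z) y = r * pderiv i f y := by
  rw [pderiv_mul i (differentiableAt_const r) hf, pderiv_const]
  ring

theorem pderiv_pow_two (i : Fin d) (hf : DifferentiableAt ℝ f y) :
    pderiv i (fun z => f z ^ 2) y = 2 * f y * pderiv i f y := by
  simp only [pow_two]
  rw [pderiv_mul i hf hf]
  ring

theorem pderiv_exp (i : Fin d) (hf : DifferentiableAt ℝ f y) :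
    pderiv i (fun z => Real.exp (f z)) y = Real.exp (f y) * pderiv i f y := by
  simp [pderiv, fderiv_exp hf]

theorem pderiv_sum {ι : Type*} (s : Finset ι) (i : Fin d)
    {F : ι → EuclideanSpace ℝ (Fin d) → ℝ} (hF : ∀ k ∈ s, DifferentiableAt ℝ (F k) y) :
    pderiv i (fun z => ∑ k ∈ s, F k z) y = ∑ k ∈ s, pderiv i (F k) y := by
  simp [pderiv, fderiv_fun_sum hF]

theorem pderiv_coord (i j : Fin d) :
    pderiv i (fun z : EuclideanSpace ℝ (Fin d) => z j) y = if i = j then 1 else 0 := by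
  have h : HasFDerivAt (fun z : EuclideanSpace ℝ (Fin d) => z j)
      (EuclideanSpace.proj j : EuclideanSpace ℝ (Fin d) →L[ℝ] ℝ) y :=
    (EuclideanSpace.proj j : EuclideanSpace ℝ (Fin d) →L[ℝ] ℝ).hasFDerivAt
  simp [pderiv, h.fderiv, stdVec, eq_comm]

theorem contDiff_pderiv (i : Fin d) (hf : ContDiff ℝ ∞ f) : ContDiff ℝ ∞ (pderiv i f) :=
  (hf.fderiv_right (m := ∞) (by simp)).clm_apply contDiff_const

theorem pderiv_comm (i j : Fin d) (hf : ContDiff ℝ ∞ f) :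
    pderiv i (pderiv j f) y = pderiv j (pderiv i f) y := by
  have h1 : DifferentiableAt ℝ (fderiv ℝ f) y :=
    (hf.fderiv_right (m := ∞) (by simp)).differentiable (by simp) y
  have h2 : ∀ k l : Fin d, pderiv k (pderiv l f) y
      = fderiv ℝ (fderiv ℝ f) y (stdVec d k) (stdVec d l) := by
    intro k l
    change fderiv ℝ (fun z => fderiv ℝ f z (stdVec d l)) y (stdVec d k) = _
    rw [fderiv_clm_apply h1 (differentiableAt_const _)]
    simp
  rw [h2, h2]
  exact (hf.contDiffAt.isSymmSndFDerivAt (by simpa using ENat.LEInfty.out)) _ _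

theorem fderiv_eq_sum_pderiv (w : EuclideanSpace ℝ (Fin d)) :
    fderiv ℝ f y w = ∑ i, w i * pderiv i f y := by
  have h : w = ∑ i, w i • stdVec d i := by
    ext j
    simp [stdVec, Pi.single_apply]
  conv_lhs => rw [h]
  simp [pderiv]

theorem eq_of_pderiv_eq_zero (hf : Differentiable ℝ f) (h : ∀ i y, pderiv i f y = 0)
    (y z : EuclideanSpace ℝ (Fin d)) : f y = f z := by
  refine is_const_of_fderiv_eq_zero hf (fun x => ?_) y z
  ext w
  simp [fderiv_eq_sum_pderiv, h]

end PartialDerivatives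

/-! ### Curvature of a conformally flat metric -/

section ConformallyFlat

variable {d : ℕ} {M : Type*} [TopologicalSpace M]
  [ChartedSpace (EuclideanSpace ℝ (Fin d)) M] [IsManifold (𝓡 d) ∞ M]

/-- In the chart `e`, whose image is the whole model space, `g = e^{2ψ} ∑ (dy^i)²`. -/
structure ConformallyFlatIn (g : SmoothMetric d M)
    (e : OpenPartialHomeomorph M (EuclideanSpace ℝ (Fin d)))
    (ψ : EuclideanSpace ℝ (Fin d) → ℝ) : Prop where
  smooth : ContDiff ℝ ∞ ψ
  gCoord_eq : ∀ y, gCoord g e y = Real.exp (2 * ψ y) • (1 : Matrix (Fin d) (Fin d) ℝ)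

namespace ConformallyFlatIn

variable {g : SmoothMetric d M} {e : OpenPartialHomeomorph M (EuclideanSpace ℝ (Fin d))}
  {ψ : EuclideanSpace ℝ (Fin d) → ℝ} (h : ConformallyFlatIn g e ψ)

include h

theorem gCoord_apply (y : EuclideanSpace ℝ (Fin d)) (i j : Fin d) :
    gCoord g e y i j = if i = j then Real.exp (2 * ψ y) else 0 := by
  simp [h.gCoord_eq, Matrix.one_apply]

theorem gInv_apply (y : EuclideanSpace ℝ (Fin d)) (i j : Fin d) :
    gInv g e y i j = if i = j then Real.exp (-(2 * ψ y)) else 0 := by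
  have : gInv g e y = Real.exp (-(2 * ψ y)) • (1 : Matrix (Fin d) (Fin d) ℝ) := by
    rw [gInv, h.gCoord_eq]
    refine Matrix.inv_eq_right_inv ?_
    rw [smul_mul_smul_comm, ← Real.exp_add]
    simp
  simp [this, Matrix.one_apply]

theorem gTrace_eq (y : EuclideanSpace ℝ (Fin d)) (B : Fin d → Fin d → ℝ) :
    gTrace g e y B = Real.exp (-(2 * ψ y)) * ∑ i, B i i := by
  simp [gTrace, h.gInv_apply, Finset.mul_sum]

theorem coInner_eq (y : EuclideanSpace ℝ (Fin d)) (α β : Fin d → ℝ) :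
    coInner g e y α β = Real.exp (-(2 * ψ y)) * ∑ i, α i * β i := by
  simp [coInner, h.gInv_apply, Finset.mul_sum, mul_assoc]

theorem differentiable : Differentiable ℝ ψ := h.smooth.differentiable (by simp)

theorem differentiable_pderiv (i : Fin d) : Differentiable ℝ (pderiv i ψ) :=
  (contDiff_pderiv i h.smooth).differentiable (by simp)

theorem pderiv_gCoord (i j k : Fin d) (y : EuclideanSpace ℝ (Fin d)) :
    pderiv i (fun z => gCoord g e z j k) y
      = if j = k then 2 * Real.exp (2 * ψ y) * pderiv i ψ y else 0 := by
  simp only [h.gCoord_apply]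
  split_ifs
  · rw [pderiv_exp i (by have := h.differentiable y; fun_prop), pderiv_const_mul i _ (h.differentiable y)]
    ring
  · exact pderiv_const _ _

/-- Both metrics are diagonal, so the sum over `l` collapses to `l = k` and the factors `e^{-2ψ}`
and `e^{2ψ}` cancel, leaving only first derivatives of `ψ`. -/
theorem christoffel_eq (k i j : Fin d) : christoffel g e k i j = fun y =>
    (if k = j then pderiv i ψ y else 0) + (if k = i then pderiv j ψ y else 0)
      - (if i = j then pderiv k ψ y else 0) := by
  funext y
  have hexp : Real.exp (-(2 * ψ y)) * Real.exp (2 * ψ y) = 1 := by rw [← Real.exp_add]; simp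
  simp only [christoffel, h.gInv_apply, h.pderiv_gCoord, ite_mul, zero_mul, Finset.sum_ite_eq,
    Finset.mem_univ, if_true]
  simp only [eq_comm (a := k)]
  linear_combination (norm := skip) ((if j = k then pderiv i ψ y else 0)
    + (if i = k then pderiv j ψ y else 0) - (if i = j then pderiv k ψ y else 0)) * hexp
  split_ifs <;> ring

theorem pderiv_christoffel (l k i j : Fin d) (y : EuclideanSpace ℝ (Fin d)) :
    pderiv l (christoffel g e k i j) y =
      (if k = j then pderiv l (pderiv i ψ) y else 0) + (if k = i then pderiv l (pderiv j ψ) y else 0)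
      - (if i = j then pderiv l (pderiv k ψ) y else 0) := by
  have hite : ∀ (p : Prop) [Decidable p] (m : Fin d),
      (fun z => if p then pderiv m ψ z else 0) = if p then pderiv m ψ else fun _ => 0 := by
    intro p _ m
    split_ifs <;> rfl
  have hd : ∀ (p : Prop) [Decidable p] (m : Fin d),
      DifferentiableAt ℝ (fun z => if p then pderiv m ψ z else 0) y := by
    intro p _ m
    rw [hite]
    split_ifs
    · exact h.differentiable_pderiv m y
    · exact differentiableAt_const _
  have hp : ∀ (p : Prop) [Decidable p] (m : Fin d),
      pderiv l (fun z => if p then pderiv m ψ z else 0) y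
        = if p then pderiv l (pderiv m ψ) y else 0 := by
    intro p _ m
    rw [hite]
    split_ifs
    · rfl
    · exact pderiv_const _ _
  rw [h.christoffel_eq, pderiv_sub l ((hd _ _).fun_add (hd _ _)) (hd _ _),
    pderiv_add l (hd _ _) (hd _ _), hp, hp, hp]

/-- This is the conformal change of Ricci starting from the flat metric. It is obtained by
contracting the explicit Christoffel symbols, using that the Hessian of `ψ` is symmetric. -/
theorem ricci_eq (y : EuclideanSpace ℝ (Fin d)) (i j : Fin d) :
    ricci g e y i j = ((d : ℝ) - 2) * (pderiv i ψ y * pderiv j ψ y - pderiv i (pderiv j ψ) y)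
      - (if i = j then ∑ k, pderiv k (pderiv k ψ) y + ((d : ℝ) - 2) * ∑ k, pderiv k ψ y ^ 2
          else 0) := by
  have hsymm := fun k l => pderiv_comm (y := y) k l h.smooth
  simp only [ricci, h.pderiv_christoffel]
  simp only [h.christoffel_eq]
  -- Freezing the first and second derivatives of `ψ` at `y` as arrays `p` and `q` leaves pure
  -- Kronecker-delta algebra.
  generalize hq : (fun k l => pderiv k (pderiv l ψ) y) = q
  generalize hp : (fun k => pderiv k ψ y) = p
  replace hq : ∀ k l, pderiv k (pderiv l ψ) y = q k l := fun k l => congrFun (congrFun hq k) l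
  replace hp : ∀ k, pderiv k ψ y = p k := fun k => congrFun hp k
  simp only [hq, hp] at hsymm ⊢
  clear hq hp
  simp only [Finset.sum_add_distrib, Finset.sum_sub_distrib, if_true, add_sub_cancel_left]
  -- The term `Γ^k_{km} Γ^m_{ij}`: here `Γ^k_{km}` has already been simplified to `p m` for each
  -- `k`.
  have h1 : ∑ _k : Fin d, ∑ m, p m * ((if m = j then p i else 0) + (if m = i then p j else 0)
      - if i = j then p m else 0) = (d : ℝ) * (2 * p i * p j - if i = j then ∑ k, p k ^ 2 else 0) := by
    by_cases hij : i = j <;>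
      simp [hij, mul_add, mul_sub, Finset.sum_add_distrib, pow_two] <;> ring
  have h2 : ∑ k, ∑ m, ((if k = m then p i else 0) + (if k = i then p m else 0)
      - if i = m then p k else 0) * ((if m = j then p k else 0) + (if m = k then p j else 0)
      - if k = j then p m else 0) = ((d : ℝ) + 2) * p i * p j
        - (if i = j then 2 * ∑ k, p k ^ 2 else 0) := by
    by_cases hij : i = j
    · subst hij
      simp [add_mul, sub_mul, mul_add, mul_sub, Finset.sum_add_distrib, pow_two]
      ring
    · simp [hij, Ne.symm hij, add_mul, sub_mul, mul_add, mul_sub, Finset.sum_add_distrib]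
      ring
  rw [h1, h2]
  by_cases hij : i = j
  · subst hij
    simp
    ring
  · simp [hij, hsymm j i]
    ring

end ConformallyFlatIn
end ConformallyFlat

/-! ## The flat tractor calculus of the model space -/

section FlatModel

variable {d : ℕ}

/-- The change of splitting `(σ, μ, ρ) ↦ (e^ψ σ, e^ψ (μ + σ dψ), e^{-ψ} (ρ - ⟨dψ, μ⟩ - σ |dψ|² / 2))`
from the Euclidean metric `δ` to `e^{2ψ} δ`. -/
noncomputable def tractorGauge (ψ : EuclideanSpace ℝ (Fin d) → ℝ) (u : LocalTractor d) : LocalTractor d := fun y =>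
  (Real.exp (ψ y) * (u y).1,
   fun j => Real.exp (ψ y) * ((u y).2.1 j + (u y).1 * pderiv j ψ y),
   Real.exp (-ψ y) * ((u y).2.2 - ∑ k, pderiv k ψ y * (u y).2.1 k
      - (1 / 2) * (u y).1 * ∑ k, pderiv k ψ y ^ 2))

/-- The tractor connection of the Euclidean metric. -/
noncomputable def flatDeriv (i : Fin d) (u : LocalTractor d) : LocalTractor d := fun y =>
  (pderiv i (fun z => (u z).1) y - (u y).2.1 i,
   fun j => pderiv i (fun z => (u z).2.1 j) y + (if i = j then (u y).2.2 else 0),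
   pderiv i (fun z => (u z).2.2) y)

/-- All the components of `u` are smooth. -/
structure SmoothLocalTractor (u : LocalTractor d) : Prop where
  fst : ContDiff ℝ ∞ fun z => (u z).1
  snd : ∀ j, ContDiff ℝ ∞ fun z => (u z).2.1 j
  trd : ContDiff ℝ ∞ fun z => (u z).2.2

theorem SmoothLocalTractor.flatDeriv (i : Fin d) {u : LocalTractor d} (hu : SmoothLocalTractor u) :
    SmoothLocalTractor (flatDeriv i u) where
  fst := (contDiff_pderiv i hu.fst).sub (hu.snd i)
  snd j := by
    refine (contDiff_pderiv i (hu.snd j)).add ?_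
    split_ifs
    · exact hu.trd
    · exact contDiff_const
  trd := contDiff_pderiv i hu.trd

/-- The change of splitting inverse to `tractorGauge ψ`. -/
noncomputable def tractorUngauge (ψ : EuclideanSpace ℝ (Fin d) → ℝ) (t : LocalTractor d) :
    LocalTractor d := fun y =>
  (Real.exp (-ψ y) * (t y).1,
   fun j => Real.exp (-ψ y) * ((t y).2.1 j - (t y).1 * pderiv j ψ y),
   Real.exp (ψ y) * (t y).2.2 + Real.exp (-ψ y) * (∑ k, pderiv k ψ y * (t y).2.1 k
      - (1 / 2) * (t y).1 * ∑ k, pderiv k ψ y ^ 2))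

theorem SmoothLocalTractor.ungauge {ψ : EuclideanSpace ℝ (Fin d) → ℝ} (hψ : ContDiff ℝ ∞ ψ)
    {t : LocalTractor d} (ht : SmoothLocalTractor t) :
    SmoothLocalTractor (tractorUngauge ψ t) where
  fst := hψ.neg.exp.mul ht.fst
  snd j := hψ.neg.exp.mul ((ht.snd j).sub (ht.fst.mul (contDiff_pderiv j hψ)))
  trd := (hψ.exp.mul ht.trd).add (hψ.neg.exp.mul
    ((ContDiff.sum fun k _ => (contDiff_pderiv k hψ).mul (ht.snd k)).sub
      ((contDiff_const.mul ht.fst).mul (ContDiff.sum fun k _ => (contDiff_pderiv k hψ).pow 2))))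

theorem tractorGauge_ungauge (ψ : EuclideanSpace ℝ (Fin d) → ℝ) (t : LocalTractor d) :
    tractorGauge ψ (tractorUngauge ψ t) = t := by
  funext y
  have e1 : Real.exp (ψ y) * Real.exp (-ψ y) = 1 := by rw [← Real.exp_add]; simp
  refine Prod.ext ?_ (Prod.ext (funext fun j => ?_) ?_)
  · simp only [tractorGauge, tractorUngauge]
    linear_combination (t y).1 * e1
  · simp only [tractorGauge, tractorUngauge]
    linear_combination (t y).2.1 j * e1
  · simp only [tractorGauge, tractorUngauge]
    have h1 : ∑ k, pderiv k ψ y * (Real.exp (-ψ y) * ((t y).2.1 k - (t y).1 * pderiv k ψ y))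
        = Real.exp (-ψ y) * (∑ k, pderiv k ψ y * (t y).2.1 k - (t y).1 * ∑ k, pderiv k ψ y ^ 2) := by
      rw [Finset.mul_sum, ← Finset.sum_sub_distrib, Finset.mul_sum]
      exact Finset.sum_congr rfl fun k _ => by ring
    rw [h1]
    linear_combination (t y).2.2 * e1

theorem flatDeriv_comm (i j : Fin d) {u : LocalTractor d} (hu : SmoothLocalTractor u) :
    flatDeriv i (flatDeriv j u) = flatDeriv j (flatDeriv i u) := by
  funext y
  have d1 := fun k => (contDiff_pderiv k hu.fst).differentiable (by simp) y
  have d2 := fun k => (hu.snd k).differentiable (by simp) y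
  have d2' := fun k l => (contDiff_pderiv l (hu.snd k)).differentiable (by simp) y
  have d3 := hu.trd.differentiable (by simp) y
  have key : ∀ a b c : Fin d, pderiv a (fun z => pderiv b (fun z => (u z).2.1 c) z
      + if b = c then (u z).2.2 else 0) y = pderiv a (pderiv b (fun z => (u z).2.1 c)) y
      + if b = c then pderiv a (fun z => (u z).2.2) y else 0 := by
    intro a b c
    split_ifs
    · exact pderiv_add a (d2' c b) d3
    · simp only [add_zero]
  refine Prod.ext ?_ (Prod.ext (funext fun k => ?_) ?_)
  · simp only [flatDeriv]
    rw [pderiv_sub i (d1 j) (d2 j), pderiv_sub j (d1 i) (d2 i), pderiv_comm i j hu.fst]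
    simp only [eq_comm (a := j)]
    ring
  · simp only [flatDeriv, key]
    rw [pderiv_comm i j (hu.snd k)]
    ring
  · exact pderiv_comm i j hu.trd

end FlatModel

/-! ### The tractor connection of a conformally flat metric -/

section ConformallyFlat

variable {d : ℕ} {M : Type*} [TopologicalSpace M]
  [ChartedSpace (EuclideanSpace ℝ (Fin d)) M] [IsManifold (𝓡 d) ∞ M]

namespace ConformallyFlatIn

variable {g : SmoothMetric d M} {e : OpenPartialHomeomorph M (EuclideanSpace ℝ (Fin d))}
  {ψ : EuclideanSpace ℝ (Fin d) → ℝ} (h : ConformallyFlatIn g e ψ)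

include h

/-- The Laplacian of `ψ` enters `Ric` only through the trace part. Subtracting `Sc / (2(d - 1)) g`
cancels it, and the common factor `d - 2` then divides out. -/
theorem schouten_eq (hd : 3 ≤ d) (y : EuclideanSpace ℝ (Fin d)) (i j : Fin d) :
    schouten g e y i j = pderiv i ψ y * pderiv j ψ y - pderiv i (pderiv j ψ) y
      - (if i = j then (1 / 2) * ∑ k, pderiv k ψ y ^ 2 else 0) := by
  have hd' : (3 : ℝ) ≤ d := by exact_mod_cast hd
  have h1 : (d : ℝ) - 1 ≠ 0 := by linarith
  have h2 : (d : ℝ) - 2 ≠ 0 := by linarith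
  have hexp : Real.exp (-(2 * ψ y)) * Real.exp (2 * ψ y) = 1 := by rw [← Real.exp_add]; simp
  have ht : gTrace g e y (ricci g e y) = Real.exp (-(2 * ψ y)) *
      (-2 * ((d : ℝ) - 1) * ∑ k, pderiv k (pderiv k ψ) y
        - ((d : ℝ) - 2) * ((d : ℝ) - 1) * ∑ k, pderiv k ψ y ^ 2) := by
    rw [h.gTrace_eq]
    simp only [h.ricci_eq, if_true, Finset.sum_sub_distrib, ← Finset.mul_sum, Finset.sum_const,
      Finset.card_univ, Fintype.card_fin, nsmul_eq_mul, ← pow_two]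
    ring
  rw [schouten, ht, h.ricci_eq, h.gCoord_apply, div_eq_iff h2]
  split_ifs
  · field_simp
    linear_combination (2 * ∑ k, pderiv k (pderiv k ψ) y
        + ((d : ℝ) - 2) * ∑ k, pderiv k ψ y ^ 2) * hexp
  · ring

/-- Conformal invariance of the tractor connection, for the rescaling of `δ` to `e^{2ψ} δ`. The
second derivatives of `ψ` produced by differentiating the gauge are exactly cancelled by those in
the Schouten tensor, and its quadratic terms absorb the rest. -/
theorem tractorDeriv_gauge (hd : 3 ≤ d) (i : Fin d) {u : LocalTractor d}
    (hu : SmoothLocalTractor u) :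
    tractorDeriv g e i (tractorGauge ψ u) = tractorGauge ψ (flatDeriv i u) := by
  funext y
  have dψ := h.differentiable y
  have dp := fun k => h.differentiable_pderiv k y
  have d1 := hu.fst.differentiable (by simp) y
  have d2 := fun k => (hu.snd k).differentiable (by simp) y
  have d3 := hu.trd.differentiable (by simp) y
  -- Bookkeeping of conformal weights: `e1` handles the factor of `g_{ij}` multiplying the bottom
  -- slot of weight `-1`, and `e2` that of `g^{ij}` raising the index of the middle slot of weight
  -- `1`.
  have e1 : Real.exp (2 * ψ y) * Real.exp (-ψ y) = Real.exp (ψ y) := by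
    rw [← Real.exp_add]; ring_nf
  have e2 : Real.exp (-(2 * ψ y)) * Real.exp (ψ y) = Real.exp (-ψ y) := by
    rw [← Real.exp_add]; ring_nf
  refine Prod.ext ?_ (Prod.ext (funext fun j => ?_) ?_)
  · simp only [tractorDeriv, tractorGauge, flatDeriv]
    rw [pderiv_mul i dψ.exp d1, pderiv_exp i dψ]
    ring
  · simp only [tractorDeriv, tractorGauge, flatDeriv]
    rw [pderiv_mul i dψ.exp ((d2 j).fun_add (d1.fun_mul (dp j))), pderiv_exp i dψ,
      pderiv_add i (d2 j) (d1.fun_mul (dp j)), pderiv_mul i d1 (dp j)]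
    have hs : ∑ k, christoffel g e k i j y * (Real.exp (ψ y) * ((u y).2.1 k + (u y).1 * pderiv k ψ y))
        = Real.exp (ψ y) * (pderiv i ψ y * ((u y).2.1 j + (u y).1 * pderiv j ψ y)
          + pderiv j ψ y * ((u y).2.1 i + (u y).1 * pderiv i ψ y)
          - if i = j then ∑ k, pderiv k ψ y * (u y).2.1 k + (u y).1 * ∑ k, pderiv k ψ y ^ 2 else 0) := by
      simp only [h.christoffel_eq, sub_mul, add_mul, ite_mul, zero_mul, Finset.sum_sub_distrib,
        Finset.sum_add_distrib, Finset.sum_ite_eq', Finset.mem_univ, if_true]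
      split_ifs
      · rw [mul_sub, mul_add (Real.exp (ψ y)) (∑ k, _), Finset.mul_sum, Finset.mul_sum,
          Finset.mul_sum, ← Finset.sum_add_distrib]
        congr 1
        · ring
        · exact Finset.sum_congr rfl fun k _ => by ring
      · simp
        ring
    rw [hs, h.gCoord_apply, h.schouten_eq hd]
    split_ifs
    · linear_combination ((u y).2.2 - ∑ k, pderiv k ψ y * (u y).2.1 k
        - (1 / 2) * (u y).1 * ∑ k, pderiv k ψ y ^ 2) * e1
    · ring
  · simp only [tractorDeriv, tractorGauge, flatDeriv, h.coInner_eq]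
    have dpm := fun k => (dp k).fun_mul (d2 k)
    have dp2 := fun k => (dp k).fun_pow 2
    have dS1 := DifferentiableAt.fun_sum (u := Finset.univ) fun k _ => dpm k
    have dS2 := DifferentiableAt.fun_sum (u := Finset.univ) fun k _ => dp2 k
    rw [pderiv_mul i dψ.fun_neg.exp ((d3.fun_sub dS1).fun_sub ((d1.const_mul _).fun_mul dS2)),
      pderiv_exp i dψ.fun_neg, pderiv_neg, pderiv_sub i (d3.fun_sub dS1) ((d1.const_mul _).fun_mul dS2),
      pderiv_sub i d3 dS1, pderiv_mul i (d1.const_mul _) dS2, pderiv_const_mul i _ d1,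
      pderiv_sum _ i (fun k _ => dpm k), pderiv_sum _ i (fun k _ => dp2 k)]
    simp only [pderiv_mul i (dp _) (d2 _), pderiv_pow_two i (dp _), h.schouten_eq hd]
    -- The contraction of the Schouten tensor with `μ`, sorted into the sums that also arise from
    -- differentiating the bottom slot.
    have hs : ∑ k, (pderiv i ψ y * pderiv k ψ y - pderiv i (pderiv k ψ) y
          - if i = k then 1 / 2 * ∑ k, pderiv k ψ y ^ 2 else 0) *
          (Real.exp (ψ y) * ((u y).2.1 k + (u y).1 * pderiv k ψ y))
        = Real.exp (ψ y) * (pderiv i ψ y * (∑ k, pderiv k ψ y * (u y).2.1 k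
          + (u y).1 * ∑ k, pderiv k ψ y ^ 2)
          - ∑ k, pderiv i (pderiv k ψ) y * (u y).2.1 k
          - (u y).1 * ∑ k, pderiv k ψ y * pderiv i (pderiv k ψ) y
          - (1 / 2 * ∑ k, pderiv k ψ y ^ 2) * ((u y).2.1 i + (u y).1 * pderiv i ψ y)) := by
      simp only [sub_mul, ite_mul, zero_mul, Finset.sum_sub_distrib, Finset.sum_ite_eq,
        Finset.mem_univ, if_true]
      rw [mul_sub, mul_sub, mul_sub]
      congr 1
      · simp only [mul_add, Finset.mul_sum, ← Finset.sum_sub_distrib, ← Finset.sum_add_distrib]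
        exact Finset.sum_congr rfl fun k _ => by ring
      · ring
    rw [hs]
    have hs2 : ∑ k, 2 * pderiv k ψ y * pderiv i (pderiv k ψ) y
        = 2 * ∑ k, pderiv k ψ y * pderiv i (pderiv k ψ) y := by
      rw [Finset.mul_sum]
      exact Finset.sum_congr rfl fun k _ => by ring
    rw [hs2]
    have hs3 : ∑ k, pderiv k ψ y * (pderiv i (fun z => (u z).2.1 k) y + if i = k then (u y).2.2 else 0)
        = ∑ k, pderiv k ψ y * pderiv i (fun z => (u z).2.1 k) y + pderiv i ψ y * (u y).2.2 := by
      simp only [mul_add, mul_ite, mul_zero, Finset.sum_add_distrib, Finset.sum_ite_eq,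
        Finset.mem_univ, if_true]
    rw [hs3, Finset.sum_add_distrib]
    linear_combination -(pderiv i ψ y * (∑ k, pderiv k ψ y * (u y).2.1 k
          + (u y).1 * ∑ k, pderiv k ψ y ^ 2)
          - ∑ k, pderiv i (pderiv k ψ) y * (u y).2.1 k
          - (u y).1 * ∑ k, pderiv k ψ y * pderiv i (pderiv k ψ) y
          - (1 / 2 * ∑ k, pderiv k ψ y ^ 2) * ((u y).2.1 i + (u y).1 * pderiv i ψ y)) * e2

/-- Any smooth local tractor is a gauge transform of its ungauged version, so commutation is
inherited from the flat connection. -/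
theorem tractorDeriv_comm (hd : 3 ≤ d) (i j : Fin d) {t : LocalTractor d}
    (ht : SmoothLocalTractor t) :
    tractorDeriv g e i (tractorDeriv g e j t) = tractorDeriv g e j (tractorDeriv g e i t) := by
  have hu := ht.ungauge h.smooth
  rw [← tractorGauge_ungauge ψ t, h.tractorDeriv_gauge hd j hu, h.tractorDeriv_gauge hd i hu,
    h.tractorDeriv_gauge hd i (hu.flatDeriv j), h.tractorDeriv_gauge hd j (hu.flatDeriv i),
    flatDeriv_comm i j hu]

end ConformallyFlatIn
end ConformallyFlat

/-! ### Parallel sections of the flat model and quadratic polynomials -/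

section FlatModel

variable {d : ℕ}

/-- The parallel sections of the flat tractor connection. -/
noncomputable def quadTractor (a : ℝ) (β : Fin d → ℝ) (ρ : ℝ) : LocalTractor d := fun y =>
  (a + ∑ j, β j * y j - ρ / 2 * ∑ j, y j ^ 2, fun j => β j - ρ * y j, ρ)

theorem contDiff_coord (j : Fin d) : ContDiff ℝ ∞ fun z : EuclideanSpace ℝ (Fin d) => z j :=
  (EuclideanSpace.proj j : EuclideanSpace ℝ (Fin d) →L[ℝ] ℝ).contDiff

theorem smooth_quadTractor (a : ℝ) (β : Fin d → ℝ) (ρ : ℝ) :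
    SmoothLocalTractor (quadTractor a β ρ) where
  fst := (contDiff_const.add (ContDiff.sum fun j _ => contDiff_const.mul (contDiff_coord j))).sub
    (contDiff_const.mul (ContDiff.sum fun j _ => (contDiff_coord j).pow 2))
  snd j := contDiff_const.sub (contDiff_const.mul (contDiff_coord j))
  trd := contDiff_const

theorem pderiv_quadTractor_fst (a : ℝ) (β : Fin d → ℝ) (ρ : ℝ) (i : Fin d)
    (y : EuclideanSpace ℝ (Fin d)) :
    pderiv i (fun z => (quadTractor a β ρ z).1) y = β i - ρ * y i := by
  have dc : ∀ j, DifferentiableAt ℝ (fun z : EuclideanSpace ℝ (Fin d) => z j) y := fun j =>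
    (contDiff_coord j).differentiable (by simp) y
  have d1 := DifferentiableAt.fun_sum (u := Finset.univ) fun j _ => (dc j).const_mul (β j)
  have d2 := DifferentiableAt.fun_sum (u := Finset.univ) fun j _ => (dc j).fun_pow 2
  simp only [quadTractor]
  rw [pderiv_sub i (d1.const_add a) (d2.const_mul _), pderiv_add i (differentiableAt_const _) d1,
    pderiv_const, pderiv_const_mul i _ d2, pderiv_sum _ i (fun j _ => (dc j).const_mul (β j)),
    pderiv_sum _ i (fun j _ => (dc j).fun_pow 2)]
  simp only [pderiv_const_mul i _ (dc _), pderiv_pow_two i (dc _), pderiv_coord, mul_ite, mul_one,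
    mul_zero, Finset.sum_ite_eq, Finset.mem_univ, if_true]
  ring

theorem flatDeriv_quadTractor (a : ℝ) (β : Fin d → ℝ) (ρ : ℝ) (i : Fin d) :
    flatDeriv i (quadTractor a β ρ) = 0 := by
  funext y
  refine Prod.ext ?_ (Prod.ext (funext fun j => ?_) ?_)
  · simp only [flatDeriv, pderiv_quadTractor_fst]
    simp [quadTractor]
  · have dc := (contDiff_coord j).differentiable (by simp) y
    simp only [flatDeriv, quadTractor]
    rw [pderiv_sub i (differentiableAt_const _) (dc.const_mul _), pderiv_const,
      pderiv_const_mul i _ dc, pderiv_coord]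
    split_ifs <;> simp
  · exact pderiv_const _ _

theorem tractorGauge_zero (ψ : EuclideanSpace ℝ (Fin d) → ℝ) : tractorGauge ψ (0 : LocalTractor d) = 0 := by
  funext y
  refine Prod.ext ?_ (Prod.ext (funext fun j => ?_) ?_) <;> simp [tractorGauge]

/-- A smooth function whose Hessian is pure trace is a quadratic polynomial. -/
theorem eq_quadTractor_fst (hd : 2 ≤ d) {u : EuclideanSpace ℝ (Fin d) → ℝ} (hu : ContDiff ℝ ∞ u)
    {f : EuclideanSpace ℝ (Fin d) → ℝ}
    (h : ∀ i j y, pderiv i (pderiv j u) y = if i = j then f y else 0) :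
    ∃ (a : ℝ) (β : Fin d → ℝ) (ρ : ℝ), u = fun y => (quadTractor a β ρ y).1 := by
  have hne : ∀ k : Fin d, ∃ j, j ≠ k := fun k => by
    have : Nontrivial (Fin d) := Fin.nontrivial_iff_two_le.2 hd
    exact exists_ne k
  have hf : ∀ j, f = pderiv j (pderiv j u) := fun j => by
    funext y
    simp [h j j y]
  have hfd : Differentiable ℝ f := by
    rw [hf ⟨0, by omega⟩]
    exact (contDiff_pderiv _ (contDiff_pderiv _ hu)).differentiable (by simp)
  -- The trace factor `f` is constant. With some `j ≠ k`, which exists because `d ≥ 2`, `∂_k f = ∂_k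
  -- ∂_j ∂_j u = ∂_j (∂_k ∂_j u)`, and the off-diagonal Hessian entry vanishes identically.
  have hf0 : ∀ k y, pderiv k f y = 0 := fun k y => by
    obtain ⟨j, hj⟩ := hne k
    rw [hf j, pderiv_comm k j (contDiff_pderiv j hu)]
    have : pderiv k (pderiv j u) = fun _ => 0 := by
      funext z
      rw [h k j z, if_neg hj.symm]
    rw [this, pderiv_const]
  have hfc : ∀ y, f y = f 0 := fun y => eq_of_pderiv_eq_zero hfd hf0 y 0
  have h1 : ∀ j y, pderiv j u y = pderiv j u 0 + f 0 * y j := by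
    intro j y
    have du := (contDiff_pderiv j hu).differentiable (by simp : (∞ : WithTop ℕ∞) ≠ 0)
    have dc := (contDiff_coord j).differentiable (by simp : (∞ : WithTop ℕ∞) ≠ 0)
    have := eq_of_pderiv_eq_zero (f := fun z => pderiv j u z - f 0 * z j)
      (du.fun_sub (dc.const_mul _)) (fun i z => by
        rw [pderiv_sub i (du z) ((dc z).const_mul _), pderiv_const_mul i _ (dc z), pderiv_coord, h,
          hfc z]
        split_ifs <;> simp) y 0
    simp only [PiLp.zero_apply, mul_zero, sub_zero] at this
    linarith
  -- These are the Taylor coefficients at the origin; the Hessian `f(0) δ` must equal `-ρ δ`.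
  refine ⟨u 0, fun j => pderiv j u 0, -f 0, ?_⟩
  have du := hu.differentiable (by simp : (∞ : WithTop ℕ∞) ≠ 0)
  have dq := (smooth_quadTractor (u 0) (fun j => pderiv j u 0) (-f 0)).fst.differentiable
    (by simp : (∞ : WithTop ℕ∞) ≠ 0)
  funext y
  have := eq_of_pderiv_eq_zero (du.fun_sub dq) (fun i z => by
    rw [pderiv_sub i (du z) (dq z), pderiv_quadTractor_fst, h1]
    ring) y 0
  have h0 : (quadTractor (u 0) (fun j => pderiv j u 0) (-f 0) 0).1 = u 0 := by simp [quadTractor]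
  rw [h0] at this
  linarith

theorem quadTractor_inj {a a' : ℝ} {β β' : Fin d → ℝ} {ρ ρ' : ℝ} {y : EuclideanSpace ℝ (Fin d)}
    (h : quadTractor a β ρ y = quadTractor a' β' ρ' y) : a = a' ∧ β = β' ∧ ρ = ρ' := by
  obtain rfl : ρ = ρ' := congrArg (fun t => t.2.2) h
  obtain rfl : β = β' := by
    funext j
    simpa [quadTractor] using congrArg (fun t => t.2.1 j) h
  have h1 := congrArg (fun t => t.1) h
  exact ⟨by simpa [quadTractor] using h1, rfl, rfl⟩

/-- The three slots are solved from the bottom up: `ρ` is read off, then `β`, then `a`. Together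
with `quadTractor_inj` this makes evaluation at `y` a bijection from parallel sections to the fibre.
-/
theorem exists_quadTractor_eq (y : EuclideanSpace ℝ (Fin d)) (u : ℝ × (Fin d → ℝ) × ℝ) :
    ∃ (a : ℝ) (β : Fin d → ℝ) (ρ : ℝ), quadTractor a β ρ y = u := by
  refine ⟨u.1 - ∑ j, (u.2.1 j + u.2.2 * y j) * y j + u.2.2 / 2 * ∑ j, y j ^ 2,
    fun j => u.2.1 j + u.2.2 * y j, u.2.2, ?_⟩
  refine Prod.ext ?_ (Prod.ext (funext fun j => ?_) rfl)
  · simp only [quadTractor]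
    ring
  · simp only [quadTractor]
    ring

/-- The gauge is triangular in the three slots with nonvanishing exponential diagonal, so it is
invertible at each point. -/
theorem tractorGauge_inj {ψ : EuclideanSpace ℝ (Fin d) → ℝ} {u u' : LocalTractor d}
    {y : EuclideanSpace ℝ (Fin d)} (h : tractorGauge ψ u y = tractorGauge ψ u' y) : u y = u' y := by
  have hpos := (Real.exp_pos (ψ y)).ne'
  have hneg := (Real.exp_pos (-ψ y)).ne'
  have h1 : (u y).1 = (u' y).1 := mul_left_cancel₀ hpos (congrArg (fun t => t.1) h)
  have h2 : (u y).2.1 = (u' y).2.1 := funext fun j => by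
    have := mul_left_cancel₀ hpos (congrArg (fun t => t.2.1 j) h)
    rw [h1] at this
    linarith
  have h3 := mul_left_cancel₀ hneg (congrArg (fun t => t.2.2) h)
  rw [h1, h2] at h3
  exact Prod.ext h1 (Prod.ext h2 (by linarith))

end FlatModel

/-! ### The almost Einstein equation in a conformally flat chart -/

section ConformallyFlat

variable {d : ℕ} {M : Type*} [TopologicalSpace M]
  [ChartedSpace (EuclideanSpace ℝ (Fin d)) M] [IsManifold (𝓡 d) ∞ M]

namespace ConformallyFlatIn

variable {g : SmoothMetric d M} {e : OpenPartialHomeomorph M (EuclideanSpace ℝ (Fin d))}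
  {ψ : EuclideanSpace ℝ (Fin d) → ℝ} (h : ConformallyFlatIn g e ψ)

include h

/-- The transformation law of tractors under `g ↦ e^{2φ} g`. -/
theorem tractorGauge_add {φ : EuclideanSpace ℝ (Fin d) → ℝ} (u : LocalTractor d)
    {y : EuclideanSpace ℝ (Fin d)} (hφ : DifferentiableAt ℝ φ y) :
    tractorGauge (fun z => ψ z + φ z) u y =
      (Real.exp (φ y) * (tractorGauge ψ u y).1,
       fun j => Real.exp (φ y) *
        ((tractorGauge ψ u y).2.1 j + (tractorGauge ψ u y).1 * pderiv j φ y),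
       Real.exp (-φ y) * ((tractorGauge ψ u y).2.2
          - coInner g e y (fun i => pderiv i φ y) (tractorGauge ψ u y).2.1
          - (1 / 2) * (tractorGauge ψ u y).1 *
            coInner g e y (fun i => pderiv i φ y) (fun i => pderiv i φ y))) := by
  have hψ := h.differentiable y
  have e1 : Real.exp (ψ y + φ y) = Real.exp (ψ y) * Real.exp (φ y) := Real.exp_add _ _
  have e2 : Real.exp (-(ψ y + φ y)) = Real.exp (-ψ y) * Real.exp (-φ y) := by
    rw [← Real.exp_add]; ring_nf
  have e3 : Real.exp (-(2 * ψ y)) * Real.exp (ψ y) = Real.exp (-ψ y) := by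
    rw [← Real.exp_add]; ring_nf
  refine Prod.ext ?_ (Prod.ext (funext fun j => ?_) ?_)
  · simp only [tractorGauge, e1]
    ring
  · simp only [tractorGauge, e1, pderiv_add j hψ hφ]
    ring
  · simp only [tractorGauge, e2, pderiv_add _ hψ hφ, h.coInner_eq]
    have s1 : ∑ k, (pderiv k ψ y + pderiv k φ y) * (u y).2.1 k = ∑ k, pderiv k ψ y * (u y).2.1 k
        + ∑ k, pderiv k φ y * (u y).2.1 k := by
      simp only [add_mul, Finset.sum_add_distrib]
    have s2 : ∑ k, (pderiv k ψ y + pderiv k φ y) ^ 2 = ∑ k, pderiv k ψ y ^ 2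
        + 2 * ∑ k, pderiv k φ y * pderiv k ψ y + ∑ k, pderiv k φ y ^ 2 := by
      simp only [Finset.mul_sum, ← Finset.sum_add_distrib]
      exact Finset.sum_congr rfl fun k _ => by ring
    have s3 : ∑ k, pderiv k φ y * (Real.exp (ψ y) * ((u y).2.1 k + (u y).1 * pderiv k ψ y))
        = Real.exp (ψ y) * (∑ k, pderiv k φ y * (u y).2.1 k
          + (u y).1 * ∑ k, pderiv k φ y * pderiv k ψ y) := by
      simp only [Finset.mul_sum, ← Finset.sum_add_distrib]
      exact Finset.sum_congr rfl fun k _ => by ring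
    have s4 : ∑ k, pderiv k φ y * pderiv k φ y = ∑ k, pderiv k φ y ^ 2 :=
      Finset.sum_congr rfl fun k _ => by ring
    rw [s1, s2, s3, s4]
    linear_combination Real.exp (-φ y) * (∑ k, pderiv k φ y * (u y).2.1 k
          + (u y).1 * ∑ k, pderiv k φ y * pderiv k ψ y
          + (1 / 2) * (u y).1 * ∑ k, pderiv k φ y ^ 2) * e3

theorem gTrace_gCoord (y : EuclideanSpace ℝ (Fin d)) (r : ℝ) :
    gTrace g e y (fun i j => r * gCoord g e y i j) = d * r := by
  have hexp : Real.exp (-(2 * ψ y)) * Real.exp (2 * ψ y) = 1 := by rw [← Real.exp_add]; simp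
  simp only [h.gTrace_eq, h.gCoord_apply, if_true, Finset.sum_const, Finset.card_univ,
    Fintype.card_fin, nsmul_eq_mul]
  linear_combination d * r * hexp

/-- The conformal covariance of the almost Einstein operator. -/
theorem aeTensor_eq (hd : 3 ≤ d) {s : SmoothFn d M} {u : EuclideanSpace ℝ (Fin d) → ℝ}
    (hu : ContDiff ℝ ∞ u) (hs : fnCoord e s = fun y => Real.exp (ψ y) * u y)
    (y : EuclideanSpace ℝ (Fin d)) (i j : Fin d) :
    aeTensor g e s y i j = Real.exp (ψ y) * (pderiv i (pderiv j u) y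
      - if i = j then (∑ k, pderiv k (pderiv k u) y) / d else 0) := by
  have hd0 : (d : ℝ) ≠ 0 := by positivity
  -- The bottom slot may be chosen as `0`: it affects the middle slot of the derivative only by a
  -- multiple of the metric, which the trace-free part discards.
  set U : LocalTractor d := fun z => (u z, fun k => pderiv k u z, 0) with hU
  have sU : SmoothLocalTractor U := ⟨hu, fun k => contDiff_pderiv k hu, contDiff_const⟩
  have hmu : ∀ k z, (tractorGauge ψ U z).2.1 k = pderiv k (fnCoord e s) z := by
    intro k z
    have dψ := h.differentiable z
    have du := hu.differentiable (by simp) z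
    rw [hs, pderiv_mul k dψ.exp du, pderiv_exp k dψ]
    simp only [tractorGauge, hU]
    ring
  -- The middle slot of the intertwining identity applied to `U`.
  have hB : ∀ k l, hessian g e s y k l + fnCoord e s y * schouten g e y k l
      = Real.exp (ψ y) * pderiv k (pderiv l u) y
        - (tractorGauge ψ U y).2.2 * gCoord g e y k l := by
    intro k l
    have key := congrArg (fun t => t.2.1 l) (congrFun (h.tractorDeriv_gauge hd k sU) y)
    have hs' : (tractorGauge ψ U y).1 = fnCoord e s y := by rw [hs]; rfl
    simp only [tractorDeriv, hmu, hs'] at key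
    have hr : (tractorGauge ψ (flatDeriv k U) y).2.1 l = Real.exp (ψ y) * pderiv k (pderiv l u) y := by
      simp [tractorGauge, flatDeriv, hU]
    rw [hr] at key
    rw [hessian]
    linear_combination key
  have hexp : Real.exp (-(2 * ψ y)) * Real.exp (2 * ψ y) = 1 := by rw [← Real.exp_add]; simp
  simp only [aeTensor, hB, h.gTrace_eq, h.gCoord_apply, if_true, Finset.sum_sub_distrib,
    ← Finset.mul_sum, Finset.sum_const, Finset.card_univ, Fintype.card_fin, nsmul_eq_mul]
  split_ifs
  · field_simp
    linear_combination (d * (tractorGauge ψ U y).2.2 * Real.exp (2 * ψ y)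
      - Real.exp (ψ y) * ∑ k, pderiv k (pderiv k u) y) * hexp
  · ring

/-- By the covariance `aeTensor_eq`, the function `u = e^{-ψ} s` has pure-trace Euclidean Hessian,
so it is a quadratic polynomial of the flat model. -/
theorem exists_quadTractor_of_aeTensor_eq_zero (hd : 3 ≤ d) {s : SmoothFn d M}
    (hs : ContDiff ℝ ∞ (fnCoord e s)) (h0 : ∀ y i j, aeTensor g e s y i j = 0) :
    ∃ (a : ℝ) (β : Fin d → ℝ) (ρ : ℝ),
      fnCoord e s = fun y => Real.exp (ψ y) * (quadTractor a β ρ y).1 := by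
  set u : EuclideanSpace ℝ (Fin d) → ℝ := fun y => Real.exp (-ψ y) * fnCoord e s y with hu
  have su : ContDiff ℝ ∞ u := h.smooth.neg.exp.mul hs
  have hsu : fnCoord e s = fun y => Real.exp (ψ y) * u y := by
    funext y
    rw [hu, ← mul_assoc, ← Real.exp_add]
    simp
  obtain ⟨a, β, ρ, hq⟩ := eq_quadTractor_fst (by omega) su (f := fun y =>
    (∑ k, pderiv k (pderiv k u) y) / d) (fun i j y => by
      have := h0 y i j
      rw [h.aeTensor_eq hd su hsu] at this
      have := (mul_eq_zero.1 this).resolve_left (Real.exp_pos _).ne'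
      linarith)
  exact ⟨a, β, ρ, by rw [hsu, hq]⟩

theorem tractorDeriv_gauge_quadTractor (hd : 3 ≤ d) (i : Fin d) (a : ℝ) (β : Fin d → ℝ) (ρ : ℝ) :
    tractorDeriv g e i (tractorGauge ψ (quadTractor a β ρ)) = 0 := by
  rw [h.tractorDeriv_gauge hd i (smooth_quadTractor a β ρ), flatDeriv_quadTractor, tractorGauge_zero]

end ConformallyFlatIn

/-! ### Parallel triples and their scale curvature -/

section Parallel

variable {g : SmoothMetric d M} {e : OpenPartialHomeomorph M (EuclideanSpace ℝ (Fin d))}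
  {ψ : EuclideanSpace ℝ (Fin d) → ℝ} {t : SmoothFn d M × OneForm d M × SmoothFn d M}

theorem formCoord_of_parallel (ht : ∀ y i, tractorDeriv g e i (tractorCoord e t) y = 0)
    (y : EuclideanSpace ℝ (Fin d)) (i : Fin d) :
    formCoord e t.2.1 y i = pderiv i (fnCoord e t.1) y := by
  have h1 : pderiv i (fnCoord e t.1) y - formCoord e t.2.1 y i = 0 :=
    congrArg (fun t => t.1) (ht y i)
  linarith

/-- The middle slot of the parallel equation, after the top slot has replaced `μ` by `dσ`. It yields
the almost Einstein equation, and it shows that `σ` determines `ρ`. -/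
theorem hessian_of_parallel (ht : ∀ y i, tractorDeriv g e i (tractorCoord e t) y = 0)
    (y : EuclideanSpace ℝ (Fin d)) (i j : Fin d) :
    hessian g e t.1 y i j + fnCoord e t.1 y * schouten g e y i j
      = -fnCoord e t.2.2 y * gCoord g e y i j := by
  have h2 := congrArg (fun t => t.2.1 j) (ht y i)
  simp only [tractorDeriv, tractorCoord, formCoord_of_parallel ht, Prod.snd_zero, Prod.fst_zero,
    Pi.zero_apply] at h2
  rw [hessian]
  linear_combination h2

theorem ConformallyFlatIn.aeTensor_of_parallel (h : ConformallyFlatIn g e ψ) (hd : d ≠ 0)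
    (ht : ∀ y i, tractorDeriv g e i (tractorCoord e t) y = 0)
    (y : EuclideanSpace ℝ (Fin d)) (i j : Fin d) : aeTensor g e t.1 y i j = 0 := by
  have hd0 : (d : ℝ) ≠ 0 := by exact_mod_cast hd
  simp only [aeTensor, hessian_of_parallel ht, h.gTrace_gCoord]
  field_simp
  ring

/-- The right-hand side is `-h(I, I)`. Tracing the middle slot gives `(J - Δ)σ = -dρ`, so the first
term of `S` is `-2σρ`, and `μ = dσ` accounts for the other. -/
theorem ConformallyFlatIn.scaleCurv_of_parallel (h : ConformallyFlatIn g e ψ) (hd : d ≠ 0)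
    (ht : ∀ y i, tractorDeriv g e i (tractorCoord e t) y = 0) (y : EuclideanSpace ℝ (Fin d)) :
    scaleCurv g e t.1 y = -(2 * fnCoord e t.1 y * fnCoord e t.2.2 y
      + coInner g e y (formCoord e t.2.1 y) (formCoord e t.2.1 y)) := by
  have hd0 : (d : ℝ) ≠ 0 := by exact_mod_cast hd
  have h1 : schoutenTrace g e y * fnCoord e t.1 y + gTrace g e y (hessian g e t.1 y)
      = -(d * fnCoord e t.2.2 y) := by
    have h2 := h.gTrace_gCoord y (-fnCoord e t.2.2 y)
    simp only [← hessian_of_parallel ht] at h2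
    rw [show -((d : ℝ) * fnCoord e t.2.2 y) = d * -fnCoord e t.2.2 y by ring, ← h2]
    simp only [schoutenTrace, h.gTrace_eq, Finset.sum_add_distrib, ← Finset.mul_sum]
    ring
  have h3 : formCoord e t.2.1 y = fun i => pderiv i (fnCoord e t.1) y :=
    funext fun i => formCoord_of_parallel ht y i
  rw [scaleCurv, h1, h3]
  field_simp
  ring

/-- The tractor metric is invariant under the gauge, and on a flat parallel section it is constant
in `y`. Its value is the one at the origin of the flat model. -/
theorem ConformallyFlatIn.scaleCurv_quadTractor (h : ConformallyFlatIn g e ψ) (hd : 3 ≤ d)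
    {a : ℝ} {β : Fin d → ℝ} {ρ : ℝ} (ht : tractorCoord e t = tractorGauge ψ (quadTractor a β ρ))
    (y : EuclideanSpace ℝ (Fin d)) : scaleCurv g e t.1 y = -(2 * a * ρ + ∑ j, β j ^ 2) := by
  have e1 : Real.exp (-(2 * ψ y)) * Real.exp (ψ y) * Real.exp (ψ y) = 1 := by
    rw [← Real.exp_add, ← Real.exp_add]; ring_nf; simp
  have e2 : Real.exp (ψ y) * Real.exp (-ψ y) = 1 := by rw [← Real.exp_add]; simp
  rw [h.scaleCurv_of_parallel (by omega) fun y i => by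
    rw [ht, h.tractorDeriv_gauge_quadTractor hd]; rfl]
  have h1 : fnCoord e t.1 y = (tractorGauge ψ (quadTractor a β ρ) y).1 := by rw [← ht]; rfl
  have h2 : formCoord e t.2.1 y = (tractorGauge ψ (quadTractor a β ρ) y).2.1 := by rw [← ht]; rfl
  have h3 : fnCoord e t.2.2 y = (tractorGauge ψ (quadTractor a β ρ) y).2.2 := by rw [← ht]; rfl
  rw [h1, h2, h3, h.coInner_eq]
  simp only [tractorGauge]
  generalize hs : (quadTractor a β ρ y).1 = s
  have s1 : ∑ k, Real.exp (ψ y) * ((quadTractor a β ρ y).2.1 k + s * pderiv k ψ y) *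
      (Real.exp (ψ y) * ((quadTractor a β ρ y).2.1 k + s * pderiv k ψ y))
      = Real.exp (ψ y) * Real.exp (ψ y) * (∑ k, (quadTractor a β ρ y).2.1 k ^ 2
        + 2 * s * ∑ k, pderiv k ψ y * (quadTractor a β ρ y).2.1 k + s ^ 2 * ∑ k, pderiv k ψ y ^ 2) := by
    simp only [Finset.mul_sum, ← Finset.sum_add_distrib]
    exact Finset.sum_congr rfl fun k _ => by ring
  have s2 : ∑ k, (quadTractor a β ρ y).2.1 k ^ 2 = ∑ k, β k ^ 2 - 2 * ρ * ∑ k, β k * y k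
      + ρ ^ 2 * ∑ k, y k ^ 2 := by
    simp only [Finset.mul_sum, ← Finset.sum_add_distrib, ← Finset.sum_sub_distrib]
    exact Finset.sum_congr rfl fun k _ => by simp only [quadTractor]; ring
  have hs' : s = a + ∑ j, β j * y j - ρ / 2 * ∑ j, y j ^ 2 := by rw [← hs]; rfl
  have hr : (quadTractor a β ρ y).2.2 = ρ := rfl
  rw [s1, hr]
  -- The `e1` and `e2` terms remove the gauge; `s2` and `hs'` cancel the dependence on `y`.
  linear_combination -(∑ k, (quadTractor a β ρ y).2.1 k ^ 2
        + 2 * s * ∑ k, pderiv k ψ y * (quadTractor a β ρ y).2.1 k + s ^ 2 * ∑ k, pderiv k ψ y ^ 2) * e1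
    - 2 * s * (ρ - ∑ k, pderiv k ψ y * (quadTractor a β ρ y).2.1 k
      - (1 / 2) * s * ∑ k, pderiv k ψ y ^ 2) * e2 - s2 - 2 * ρ * hs'

end Parallel
end ConformallyFlat

/-! ### Differentials and smoothness in charts -/

section Differential

variable {d : ℕ} {M : Type*} [TopologicalSpace M]
  [ChartedSpace (EuclideanSpace ℝ (Fin d)) M] [IsManifold (𝓡 d) ∞ M]

theorem contMDiff_mfderiv_section (f : SmoothFn d M) :
    ContMDiff (𝓡 d) ((𝓡 d).prod 𝓘(ℝ, EuclideanSpace ℝ (Fin d) →L[ℝ] ℝ)) ∞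
      (fun x : M => TotalSpace.mk' (EuclideanSpace ℝ (Fin d) →L[ℝ] ℝ)
        (E := fun x : M => TangentSpace (𝓡 d) x →L[ℝ] Bundle.Trivial M ℝ x)
        x (mfderiv (𝓡 d) 𝓘(ℝ, ℝ) f x)) := by
  intro x
  rw [contMDiffAt_hom_bundle]
  refine ⟨contMDiffAt_id, ?_⟩
  have h1 := (f.contMDiff x).mfderiv_const (m := ∞) (by simp)
  refine h1.congr_of_eventuallyEq (Filter.Eventually.of_forall fun y => ?_)
  ext v
  simp [inTangentCoordinates, ContinuousLinearMap.inCoordinates]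
  rfl

/-- The differential of a smooth function. -/
noncomputable def differential (f : SmoothFn d M) : OneForm d M where
  toFun x := mfderiv (𝓡 d) 𝓘(ℝ, ℝ) f x
  contMDiff_toFun := contMDiff_mfderiv_section f

variable {e : OpenPartialHomeomorph M (EuclideanSpace ℝ (Fin d))}

theorem contMDiffAt_chart_symm (he : e ∈ atlas (EuclideanSpace ℝ (Fin d)) M)
    {y : EuclideanSpace ℝ (Fin d)} (hy : y ∈ e.target) : ContMDiffAt (𝓡 d) (𝓡 d) ∞ e.symm y :=
  (contMDiffOn_symm_of_mem_maximalAtlas (IsManifold.subset_maximalAtlas he)).contMDiffAt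
    (e.open_target.mem_nhds hy)

theorem mfderiv_coordVec {F : Type*} [NormedAddCommGroup F] [NormedSpace ℝ F] {f : M → F}
    (he : e ∈ atlas (EuclideanSpace ℝ (Fin d)) M) {y : EuclideanSpace ℝ (Fin d)} (hy : y ∈ e.target)
    (hf : ContMDiff (𝓡 d) 𝓘(ℝ, F) ∞ f) (i : Fin d) :
    mfderiv (𝓡 d) 𝓘(ℝ, F) f (e.symm y) (coordVec e y i)
      = fderiv ℝ (fun z => f (e.symm z)) y (stdVec d i) := by
  have h1 := (hf (e.symm y)).mdifferentiableAt (by simp)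
  have h2 := (contMDiffAt_chart_symm he hy).mdifferentiableAt (by simp)
  have h3 := mfderiv_comp y h1 h2
  rw [mfderiv_eq_fderiv] at h3
  exact (congrArg (fun L : EuclideanSpace ℝ (Fin d) →L[ℝ] F => L (stdVec d i)) h3).symm

theorem formCoord_differential (he : e ∈ atlas (EuclideanSpace ℝ (Fin d)) M) {y : EuclideanSpace ℝ (Fin d)}
    (hy : y ∈ e.target) (f : SmoothFn d M) (i : Fin d) :
    formCoord e (differential f) y i = pderiv i (fnCoord e f) y :=
  mfderiv_coordVec he hy f.contMDiff i

theorem contDiff_fnCoord (he : e ∈ atlas (EuclideanSpace ℝ (Fin d)) M) (ht : e.target = Set.univ)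
    (f : SmoothFn d M) : ContDiff ℝ ∞ (fnCoord e f) := by
  rw [← contMDiff_iff_contDiff]
  intro y
  exact (f.contMDiff _).comp y (contMDiffAt_chart_symm he (by simp [ht]))

/-- A function is smooth if its expressions in all charts are. -/
theorem contMDiff_of_charts {F : Type*} [NormedAddCommGroup F] [NormedSpace ℝ F] {f : M → F}
    (hf : ∀ e ∈ atlas (EuclideanSpace ℝ (Fin d)) M, ContDiffOn ℝ ∞ (fun z => f (e.symm z)) e.target) :
    ContMDiff (𝓡 d) 𝓘(ℝ, F) ∞ f := by
  intro x
  set e := chartAt (EuclideanSpace ℝ (Fin d)) x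
  have he : e ∈ atlas (EuclideanSpace ℝ (Fin d)) M := chart_mem_atlas _ x
  have hx : x ∈ e.source := mem_chart_source _ x
  have h1 : ContMDiffAt 𝓘(ℝ, EuclideanSpace ℝ (Fin d)) 𝓘(ℝ, F) ∞ (fun z => f (e.symm z)) (e x) :=
    ((hf e he).contDiffAt (e.open_target.mem_nhds (e.map_source hx))).contMDiffAt
  have h2 : ContMDiffAt (𝓡 d) (𝓡 d) ∞ e x :=
    (contMDiffOn_of_mem_maximalAtlas (IsManifold.subset_maximalAtlas he)).contMDiffAt
      (e.open_source.mem_nhds hx)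
  refine (h1.comp x h2).congr_of_eventuallyEq ?_
  filter_upwards [e.open_source.mem_nhds hx] with z hz
  simp [e.left_inv hz]

end Differential

/-! ## Stereographic coordinates on the sphere -/

section Stereographic

variable {d : ℕ}

instance factFinrankEuclideanSpace (d : ℕ) :
    Fact (Module.finrank ℝ (EuclideanSpace ℝ (Fin (d + 1))) = d + 1) :=
  ⟨finrank_euclideanSpace_fin⟩

theorem mem_atlas_sphere {e : OpenPartialHomeomorph (USphere d) (EuclideanSpace ℝ (Fin d))} :
    e ∈ atlas (EuclideanSpace ℝ (Fin d)) (USphere d) ↔ ∃ v : USphere d, e = stereographic' d v :=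
  Iff.rfl

/-- The linear isometry from the model space onto the hyperplane `v^⊥` used by the stereographic
projection from `v`. -/
noncomputable def stereoFrame (v : USphere d) :
    EuclideanSpace ℝ (Fin d) →ₗᵢ[ℝ] EuclideanSpace ℝ (Fin (d + 1)) :=
  (Submodule.subtypeₗᵢ _).comp (OrthonormalBasis.fromOrthogonalSpanSingleton (𝕜 := ℝ) d
    (ne_zero_of_mem_unit_sphere v)).repr.symm.toLinearIsometry

theorem inner_stereoFrame_left (v : USphere d) (y : EuclideanSpace ℝ (Fin d)) :
    inner ℝ (v : EuclideanSpace ℝ (Fin (d + 1))) (stereoFrame v y) = 0 :=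
  Submodule.mem_orthogonal_singleton_iff_inner_right.1 (Subtype.property
    ((OrthonormalBasis.fromOrthogonalSpanSingleton (𝕜 := ℝ) d
    (ne_zero_of_mem_unit_sphere v)).repr.symm y))

theorem inner_self_sphere (v : USphere d) :
    inner ℝ (v : EuclideanSpace ℝ (Fin (d + 1))) (v : EuclideanSpace ℝ (Fin (d + 1))) = 1 := by
  rw [real_inner_self_eq_norm_sq, norm_eq_of_mem_sphere]
  norm_num

/-- The squared norm of the model space. -/
noncomputable def sqNorm (y : EuclideanSpace ℝ (Fin d)) : ℝ := ∑ j, y j ^ 2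

theorem sqNorm_nonneg (y : EuclideanSpace ℝ (Fin d)) : 0 ≤ sqNorm y :=
  Finset.sum_nonneg fun j _ => sq_nonneg (y j)

theorem sqNorm_add_four_pos (y : EuclideanSpace ℝ (Fin d)) : 0 < sqNorm y + 4 := by
  linarith [sqNorm_nonneg y]

theorem sqNorm_eq (y : EuclideanSpace ℝ (Fin d)) : sqNorm y = ‖y‖ ^ 2 := by
  rw [EuclideanSpace.norm_sq_eq]
  simp [sqNorm]

theorem contDiff_sqNorm : ContDiff ℝ ∞ (sqNorm (d := d)) :=
  ContDiff.sum fun j _ => (contDiff_coord j).pow 2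

theorem pderiv_sqNorm (i : Fin d) (y : EuclideanSpace ℝ (Fin d)) :
    pderiv i sqNorm y = 2 * y i := by
  have dc : ∀ j, DifferentiableAt ℝ (fun z : EuclideanSpace ℝ (Fin d) => z j) y := fun j =>
    (contDiff_coord j).differentiable (by simp) y
  have : sqNorm (d := d) = fun z => ∑ j, z j ^ 2 := rfl
  rw [this, pderiv_sum _ i fun j _ => (dc j).fun_pow 2]
  simp [pderiv_pow_two i (dc _), pderiv_coord]

/-- Separating off the constant `v` leaves one scalar factor times a vector affine in `y`, which is
convenient to differentiate. In this normalization `y = 0` corresponds to `-v`. -/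
theorem stereographic_symm_eq (v : USphere d) (y : EuclideanSpace ℝ (Fin d)) :
    ((stereographic' d v).symm y : EuclideanSpace ℝ (Fin (d + 1)))
      = (v : EuclideanSpace ℝ (Fin (d + 1)))
        + (sqNorm y + 4)⁻¹ • ((4 : ℝ) • stereoFrame v y - (8 : ℝ) • (v : EuclideanSpace ℝ (Fin (d + 1)))) := by
  have hq := (sqNorm_add_four_pos y).ne'
  have hn : ‖stereoFrame v y‖ ^ 2 = sqNorm y := by rw [LinearIsometry.norm_map, sqNorm_eq]
  have h1 := stereographic'_symm_apply v y
  change _ = (‖stereoFrame v y‖ ^ 2 + 4)⁻¹ • (4 : ℝ) • stereoFrame v y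
    + (‖stereoFrame v y‖ ^ 2 + 4)⁻¹ • (‖stereoFrame v y‖ ^ 2 - 4) • v.val at h1
  rw [h1, hn]
  have : (v : EuclideanSpace ℝ (Fin (d + 1))) = ((sqNorm y + 4)⁻¹ * (sqNorm y + 4)) • (v : EuclideanSpace ℝ (Fin (d + 1))) := by
    rw [inv_mul_cancel₀ hq, one_smul]
  nth_rewrite 2 [this]
  module

/-- The image of the coordinate vector `∂_i` in the ambient space. -/
noncomputable def stereoVec (v : USphere d) (y : EuclideanSpace ℝ (Fin d)) (i : Fin d) :
    EuclideanSpace ℝ (Fin (d + 1)) :=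
  (-(2 * y i) * ((sqNorm y + 4) ^ 2)⁻¹) •
    ((4 : ℝ) • stereoFrame v y - (8 : ℝ) • (v : EuclideanSpace ℝ (Fin (d + 1))))
  + ((sqNorm y + 4)⁻¹ * 4) • stereoFrame v (stdVec d i)

theorem contDiff_inv_sqNorm_add_four :
    ContDiff ℝ ∞ fun z : EuclideanSpace ℝ (Fin d) => (sqNorm z + 4)⁻¹ :=
  (contDiff_sqNorm.add contDiff_const).inv fun y => (sqNorm_add_four_pos y).ne'

theorem contDiff_stereoFrame (v : USphere d) : ContDiff ℝ ∞ fun z => stereoFrame v z :=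
  (stereoFrame v).toContinuousLinearMap.contDiff

theorem contDiff_stereographic_symm (v : USphere d) : ContDiff ℝ ∞ fun z =>
    ((stereographic' d v).symm z : EuclideanSpace ℝ (Fin (d + 1))) := by
  have h1 := contDiff_inv_sqNorm_add_four (d := d)
  have h2 := contDiff_stereoFrame v
  simp only [stereographic_symm_eq]
  fun_prop

theorem contDiff_stereoVec (v : USphere d) (i : Fin d) : ContDiff ℝ ∞ fun z => stereoVec v z i := by
  have h1 := contDiff_inv_sqNorm_add_four (d := d)
  have h2 := contDiff_stereoFrame v
  have h3 := contDiff_coord i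
  simp only [stereoVec, ← inv_pow]
  fun_prop

theorem fderiv_stereographic_symm (v : USphere d) (y : EuclideanSpace ℝ (Fin d)) (i : Fin d) :
    fderiv ℝ (fun z => ((stereographic' d v).symm z : EuclideanSpace ℝ (Fin (d + 1)))) y
      (stdVec d i) = stereoVec v y i := by
  have hq := (sqNorm_add_four_pos y).ne'
  have hs := (contDiff_sqNorm.differentiable (by simp) y).hasFDerivAt
  have h1 : HasFDerivAt (fun z => (sqNorm z + 4)⁻¹) _ y :=
    (hasDerivAt_inv hq).comp_hasFDerivAt y (hs.add_const 4)
  have h2 : HasFDerivAt (fun z => (4 : ℝ) • stereoFrame v z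
      - (8 : ℝ) • (v : EuclideanSpace ℝ (Fin (d + 1))))
      ((4 : ℝ) • (stereoFrame v).toContinuousLinearMap) y :=
    (((stereoFrame v).toContinuousLinearMap.hasFDerivAt).const_smul (4 : ℝ)).sub_const _
  have h3 := (h1.fun_smul h2).const_add (v : EuclideanSpace ℝ (Fin (d + 1)))
  simp only [stereographic_symm_eq]
  rw [h3.fderiv]
  have hp : fderiv ℝ sqNorm y (stdVec d i) = 2 * y i := pderiv_sqNorm i y
  simp [stereoVec, hp]
  module

theorem sphereIncl_coordVec (v : USphere d) (y : EuclideanSpace ℝ (Fin d)) (i : Fin d) :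
    sphereIncl d ((stereographic' d v).symm y) (coordVec (stereographic' d v) y i)
      = stereoVec v y i := by
  rw [← fderiv_stereographic_symm]
  exact mfderiv_coordVec (mem_atlas_sphere.2 ⟨v, rfl⟩) (by simp) contMDiff_coe_sphere i

/-- Stereographic projection is conformal. With `q = |y|²`, the vector `W = 4 E(y) - 8 v`, where `E`
is `stereoFrame v`, satisfies `|W|² = 16 (q + 4)` and `⟨W, E ∂_i⟩ = 4 y_i`. Hence the terms in `y_i
y_j` cancel and only the product of the `E ∂_i` remains. -/
theorem inner_stereoVec (v : USphere d) (y : EuclideanSpace ℝ (Fin d)) (i j : Fin d) :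
    inner ℝ (stereoVec v y i) (stereoVec v y j)
      = if i = j then (4 / (sqNorm y + 4)) ^ 2 else 0 := by
  have hq := (sqNorm_add_four_pos y).ne'
  have hv := inner_self_sphere v
  have hl := inner_stereoFrame_left v
  have hr : ∀ z, inner ℝ (stereoFrame v z) (v : EuclideanSpace ℝ (Fin (d + 1))) = 0 := fun z => by
    rw [real_inner_comm, hl]
  have hyy : inner ℝ y y = sqNorm y := by rw [real_inner_self_eq_norm_sq, sqNorm_eq]
  have hy : ∀ k, inner ℝ y (stdVec d k) = y k := fun k => by
    simp [stdVec, EuclideanSpace.inner_single_right]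
  have hy' : ∀ k, inner ℝ (stdVec d k) y = y k := fun k => by rw [real_inner_comm, hy]
  have hss : ∀ k l, inner ℝ (stdVec d k) (stdVec d l) = if k = l then (1 : ℝ) else 0 := fun k l => by
    simp [stdVec, EuclideanSpace.inner_single_left]
  simp only [stereoVec, inner_add_left, inner_add_right, inner_sub_left, inner_sub_right,
    real_inner_smul_left, real_inner_smul_right, hv, hl, hr, LinearIsometry.inner_map_map, hyy, hy,
    hy', hss]
  split_ifs
  · field_simp
    ring
  · field_simp
    ring

end Stereographic

/-! ## The standard conformal structure in stereographic coordinates -/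

section SphereConformal

variable {d : ℕ}

/-- The conformal factor of the round metric in stereographic coordinates. -/
noncomputable def roundFactor (y : EuclideanSpace ℝ (Fin d)) : ℝ := Real.log (4 / (sqNorm y + 4))

theorem exp_roundFactor (y : EuclideanSpace ℝ (Fin d)) :
    Real.exp (roundFactor y) = 4 / (sqNorm y + 4) :=
  Real.exp_log (div_pos (by norm_num) (sqNorm_add_four_pos y))

theorem exp_two_mul_roundFactor (y : EuclideanSpace ℝ (Fin d)) :
    Real.exp (2 * roundFactor y) = (4 / (sqNorm y + 4)) ^ 2 := by
  rw [two_mul, Real.exp_add, exp_roundFactor, pow_two]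

theorem contDiff_roundFactor : ContDiff ℝ ∞ (roundFactor (d := d)) := by
  have h1 : ContDiff ℝ ∞ fun z : EuclideanSpace ℝ (Fin d) => 4 / (sqNorm z + 4) := by
    simp only [div_eq_mul_inv]
    exact contDiff_const.mul contDiff_inv_sqNorm_add_four
  exact h1.log fun y => (div_pos (by norm_num) (sqNorm_add_four_pos y)).ne'

theorem conformallyFlatIn_round (v : USphere d) :
    ConformallyFlatIn (roundMetric d) (stereographic' d v) roundFactor where
  smooth := contDiff_roundFactor
  gCoord_eq y := by
    ext i j
    have h1 : gCoord (roundMetric d) (stereographic' d v) y i j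
        = inner ℝ (stereoVec v y i) (stereoVec v y j) := by
      rw [← sphereIncl_coordVec, ← sphereIncl_coordVec]
      rfl
    rw [h1, inner_stereoVec, exp_two_mul_roundFactor]
    simp [Matrix.one_apply]

theorem conformallyFlatIn_of_rescaling (v : USphere d) {g : SmoothMetric d (USphere d)}
    {φ : SmoothFn d (USphere d)} (h : IsRescaling (roundMetric d) g φ) :
    ConformallyFlatIn g (stereographic' d v)
      (fun y => roundFactor y + fnCoord (stereographic' d v) φ y) where
  smooth := contDiff_roundFactor.add
    (contDiff_fnCoord (mem_atlas_sphere.2 ⟨v, rfl⟩) (stereographic'_target v) φ)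
  gCoord_eq y := by
    have h1 : gCoord g (stereographic' d v) y
        = Real.exp (2 * fnCoord (stereographic' d v) φ y) • gCoord (roundMetric d) (stereographic' d v) y := by
      ext i j
      exact h _ _ _
    rw [h1, (conformallyFlatIn_round v).gCoord_eq, smul_smul, ← Real.exp_add, mul_add, add_comm]

/-- The ambient images `stereoVec` are orthogonal and nonzero, so the coordinate vectors are
independent. Counting dimensions, they span. -/
theorem span_coordVec (v : USphere d) (y : EuclideanSpace ℝ (Fin d))
    (w : TangentSpace (𝓡 d) ((stereographic' d v).symm y)) :
    ∃ a : Fin d → ℝ, w = ∑ i, a i • coordVec (stereographic' d v) y i := by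
  have h0 : LinearIndependent ℝ (fun i => stereoVec v y i) := by
    refine linearIndependent_of_ne_zero_of_inner_eq_zero (𝕜 := ℝ) (fun i hi => ?_) fun i j hij => ?_
    · have h1 := inner_stereoVec v y i i
      rw [hi, inner_zero_left, if_pos rfl] at h1
      have := sqNorm_add_four_pos y
      have : 0 < (4 / (sqNorm y + 4)) ^ 2 := by positivity
      linarith
    · exact (inner_stereoVec v y i j).trans (if_neg hij)
  have h1 : LinearIndependent ℝ (coordVec (stereographic' d v) y) := by
    refine LinearIndependent.of_comp (sphereIncl d ((stereographic' d v).symm y)).toLinearMap ?_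
    have : (sphereIncl d ((stereographic' d v).symm y)).toLinearMap ∘ coordVec (stereographic' d v) y
        = fun i => stereoVec v y i := funext fun i => sphereIncl_coordVec v y i
    rw [this]
    exact h0
  have : FiniteDimensional ℝ (TangentSpace (𝓡 d) ((stereographic' d v).symm y)) :=
    inferInstanceAs (FiniteDimensional ℝ (EuclideanSpace ℝ (Fin d)))
  have h2 : Submodule.span ℝ (Set.range (coordVec (stereographic' d v) y)) = ⊤ :=
    h1.span_eq_top_of_card_eq_finrank' (finrank_euclideanSpace (ι := Fin d)).symm
  have h3 : w ∈ Submodule.span ℝ (Set.range (coordVec (stereographic' d v) y)) := by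
    rw [h2]; trivial
  obtain ⟨a, ha⟩ := (Submodule.mem_span_range_iff_exists_fun ℝ).1 h3
  exact ⟨a, ha.symm⟩

theorem eq_of_eq_coordVec (v : USphere d) (y : EuclideanSpace ℝ (Fin d))
    {L L' : TangentSpace (𝓡 d) ((stereographic' d v).symm y) →L[ℝ] ℝ}
    (h : ∀ j, L (coordVec (stereographic' d v) y j) = L' (coordVec (stereographic' d v) y j))
    (w : TangentSpace (𝓡 d) ((stereographic' d v).symm y)) : L w = L' w := by
  obtain ⟨a, rfl⟩ := span_coordVec v y w
  simp only [map_sum, map_smul, h]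

theorem exists_stereographic_symm_eq (x : USphere d) :
    ∃ (v : USphere d) (y : EuclideanSpace ℝ (Fin d)), (stereographic' d v).symm y = x :=
  ⟨-x, stereographic' d (-x) x, (stereographic' d (-x)).left_inv
    (mem_chart_source (EuclideanSpace ℝ (Fin d)) x)⟩

theorem oneForm_ext_formCoord {μ ν : OneForm d (USphere d)}
    (h : ∀ (v : USphere d) (y : EuclideanSpace ℝ (Fin d)) (j : Fin d),
      formCoord (stereographic' d v) μ y j = formCoord (stereographic' d v) ν y j) : μ = ν := by
  refine ContMDiffSection.ext fun x => ?_
  obtain ⟨v, y, rfl⟩ := exists_stereographic_symm_eq x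
  exact ContinuousLinearMap.ext fun w => eq_of_eq_coordVec v y (h v y) w

theorem smoothFn_ext_fnCoord {f k : SmoothFn d (USphere d)}
    (h : ∀ (v : USphere d) (y : EuclideanSpace ℝ (Fin d)),
      fnCoord (stereographic' d v) f y = fnCoord (stereographic' d v) k y) : f = k := by
  refine ContMDiffMap.ext fun x => ?_
  obtain ⟨v, y, rfl⟩ := exists_stereographic_symm_eq x
  exact h v y

/-! ## The gradient of a function on the sphere, as a vector of the ambient space -/

/-- The gradient for the round metric, in stereographic coordinates. -/
noncomputable def stereoGrad (v : USphere d) (φ : SmoothFn d (USphere d))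
    (y : EuclideanSpace ℝ (Fin d)) : EuclideanSpace ℝ (Fin (d + 1)) :=
  ∑ j, (Real.exp (-(2 * roundFactor y)) * pderiv j (fnCoord (stereographic' d v) φ) y) • stereoVec v y j

/-- The gradient for the round metric. -/
noncomputable def sphereGrad (φ : SmoothFn d (USphere d)) (x : USphere d) :
    EuclideanSpace ℝ (Fin (d + 1)) :=
  stereoGrad (-x) φ (stereographic' d (-x) x)

theorem stereoGrad_mem_range (v : USphere d) (φ : SmoothFn d (USphere d))
    (y : EuclideanSpace ℝ (Fin d)) :
    ∃ w, stereoGrad v φ y = sphereIncl d ((stereographic' d v).symm y) w := by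
  refine ⟨∑ j, (Real.exp (-(2 * roundFactor y)) * pderiv j (fnCoord (stereographic' d v) φ) y) •
    coordVec (stereographic' d v) y j, ?_⟩
  rw [map_sum]
  simp only [map_smul, sphereIncl_coordVec, stereoGrad]

theorem inner_stereoGrad_stereoVec (v : USphere d) (φ : SmoothFn d (USphere d))
    (y : EuclideanSpace ℝ (Fin d)) (i : Fin d) :
    inner ℝ (stereoGrad v φ y) (stereoVec v y i) = pderiv i (fnCoord (stereographic' d v) φ) y := by
  have hexp : Real.exp (-(2 * roundFactor y)) * Real.exp (2 * roundFactor y) = 1 := by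
    rw [← Real.exp_add]; simp
  simp only [stereoGrad, sum_inner, real_inner_smul_left, inner_stereoVec,
    ← exp_two_mul_roundFactor, mul_ite, mul_zero, Finset.sum_ite_eq', Finset.mem_univ, if_true]
  linear_combination pderiv i (fnCoord (stereographic' d v) φ) y * hexp

theorem inner_stereoGrad (v : USphere d) (φ : SmoothFn d (USphere d))
    (y : EuclideanSpace ℝ (Fin d)) (w : TangentSpace (𝓡 d) ((stereographic' d v).symm y)) :
    inner ℝ (stereoGrad v φ y) (sphereIncl d ((stereographic' d v).symm y) w)
      = differential φ ((stereographic' d v).symm y) w := by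
  obtain ⟨a, rfl⟩ := span_coordVec v y w
  rw [map_sum, map_sum, inner_sum]
  refine Finset.sum_congr rfl fun i _ => ?_
  rw [map_smul, map_smul, sphereIncl_coordVec, real_inner_smul_right, inner_stereoGrad_stereoVec,
    ← formCoord_differential (mem_atlas_sphere.2 ⟨v, rfl⟩) (by simp)]
  rfl

/-- The difference of the two candidates is tangent at the common point, and both represent `dφ`
against every tangent vector. The difference is therefore orthogonal to itself. -/
theorem stereoGrad_unique {v v' : USphere d} (φ : SmoothFn d (USphere d))
    {y y' : EuclideanSpace ℝ (Fin d)}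
    (h : (stereographic' d v).symm y = (stereographic' d v').symm y') :
    stereoGrad v φ y = stereoGrad v' φ y' := by
  obtain ⟨w, hw⟩ := stereoGrad_mem_range v φ y
  obtain ⟨w', hw'⟩ := stereoGrad_mem_range v' φ y'
  have h1 := inner_stereoGrad v φ y
  have h2 := inner_stereoGrad v' φ y'
  generalize (stereographic' d v).symm y = x at *
  subst h
  rw [← sub_eq_zero, ← inner_self_eq_zero (𝕜 := ℝ)]
  nth_rewrite 2 [hw, hw']
  rw [← map_sub, inner_sub_left, h1, h2, sub_self]

theorem sphereGrad_symm (v : USphere d) (φ : SmoothFn d (USphere d)) (y : EuclideanSpace ℝ (Fin d)) :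
    sphereGrad φ ((stereographic' d v).symm y) = stereoGrad v φ y :=
  stereoGrad_unique φ ((stereographic' d (-(stereographic' d v).symm y)).left_inv
    (mem_chart_source (EuclideanSpace ℝ (Fin d)) ((stereographic' d v).symm y)))

/-- Realizing the gradient as an ambient vector makes `g₀⁻¹(dφ, μ)` and `|dφ|²` global smooth
functions given by ordinary inner products. The bottom slot `einsteinBottom` needs this. -/
theorem contMDiff_sphereGrad (φ : SmoothFn d (USphere d)) :
    ContMDiff (𝓡 d) 𝓘(ℝ, EuclideanSpace ℝ (Fin (d + 1))) ∞ (sphereGrad φ) := by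
  refine contMDiff_of_charts fun e he => ?_
  obtain ⟨v, rfl⟩ := mem_atlas_sphere.1 he
  simp only [sphereGrad_symm]
  refine ContDiff.contDiffOn (ContDiff.sum fun j _ => ?_)
  have h1 := contDiff_roundFactor (d := d)
  have h2 := contDiff_pderiv j (contDiff_fnCoord he (stereographic'_target v) φ)
  have h3 := contDiff_stereoVec v j
  fun_prop

theorem inner_stereoGrad_self (v : USphere d) (φ : SmoothFn d (USphere d))
    (y : EuclideanSpace ℝ (Fin d)) :
    inner ℝ (stereoGrad v φ y) (stereoGrad v φ y) = coInner (roundMetric d) (stereographic' d v) y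
      (fun i => pderiv i (fnCoord (stereographic' d v) φ) y)
      (fun i => pderiv i (fnCoord (stereographic' d v) φ) y) := by
  rw [(conformallyFlatIn_round v).coInner_eq]
  nth_rewrite 2 [stereoGrad]
  simp only [inner_sum, real_inner_smul_right, inner_stereoGrad_stereoVec, Finset.mul_sum]
  exact Finset.sum_congr rfl fun k _ => by ring

theorem inner_stereoGrad_right (v : USphere d) (φ : SmoothFn d (USphere d))
    (y : EuclideanSpace ℝ (Fin d)) (b : EuclideanSpace ℝ (Fin (d + 1))) :
    inner ℝ b (stereoGrad v φ y) = coInner (roundMetric d) (stereographic' d v) y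
      (fun i => pderiv i (fnCoord (stereographic' d v) φ) y)
      (fun i => inner ℝ b (stereoVec v y i)) := by
  rw [(conformallyFlatIn_round v).coInner_eq, stereoGrad]
  simp only [inner_sum, real_inner_smul_right, Finset.mul_sum]
  exact Finset.sum_congr rfl fun k _ => by ring

end SphereConformal

/-! ### The parallel tractors attached to the functions `c + ⟨b, x⟩` -/

section EinsteinTractors

variable {d : ℕ}

theorem pderiv_inner_stereographic (v : USphere d) (b : EuclideanSpace ℝ (Fin (d + 1))) (i : Fin d)
    (y : EuclideanSpace ℝ (Fin d)) :
    pderiv i (fun z => inner ℝ b ((stereographic' d v).symm z : EuclideanSpace ℝ (Fin (d + 1)))) y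
      = inner ℝ b (stereoVec v y i) := by
  rw [← fderiv_stereographic_symm]
  have h := ((contDiff_stereographic_symm v).differentiable (by simp) y).hasFDerivAt
  have h2 := (innerSL ℝ b).hasFDerivAt.comp y h
  have h3 : HasFDerivAt (fun z => inner ℝ b ((stereographic' d v).symm z : EuclideanSpace ℝ (Fin (d + 1))))
    _ y := h2
  rw [pderiv, h3.fderiv]
  rfl

theorem inner_stereoFrame_right (v : USphere d) (b : EuclideanSpace ℝ (Fin (d + 1)))
    (y : EuclideanSpace ℝ (Fin d)) :
    inner ℝ b (stereoFrame v y) = ∑ j, inner ℝ b (stereoFrame v (stdVec d j)) * y j := by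
  have h : y = ∑ j, y j • stdVec d j := by
    ext k
    simp [stdVec, Pi.single_apply]
  conv_lhs => rw [h]
  simp only [map_sum, map_smul, inner_sum, real_inner_smul_right]
  exact Finset.sum_congr rfl fun j _ => mul_comm _ _

/-- The flat model, in stereographic coordinates, of the parallel tractor with
`σ = c + ⟨b, x⟩` in the scale of the round metric. -/
noncomputable def stereoTractor (v : USphere d) (c : ℝ) (b : EuclideanSpace ℝ (Fin (d + 1))) :
    LocalTractor d :=
  quadTractor (c - inner ℝ b v) (fun j => inner ℝ b (stereoFrame v (stdVec d j)))
    (-(c + inner ℝ b v) / 2)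

/-- The right-hand side makes sense on the sphere without reference to a chart, so the local
parallel sections with the same `c` and `b` fit together globally. -/
theorem gauge_stereoTractor (v : USphere d) (c : ℝ) (b : EuclideanSpace ℝ (Fin (d + 1)))
    (y : EuclideanSpace ℝ (Fin d)) :
    tractorGauge roundFactor (stereoTractor v c b) y =
      (c + inner ℝ b ((stereographic' d v).symm y : EuclideanSpace ℝ (Fin (d + 1))),
       fun j => inner ℝ b (stereoVec v y j),
       (inner ℝ b ((stereographic' d v).symm y : EuclideanSpace ℝ (Fin (d + 1))) - c) / 2) := by
  -- The top slot is needed at all points, since its derivative yields the middle slot.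
  have hfst : ∀ z, Real.exp (roundFactor z) * (stereoTractor v c b z).1
      = c + inner ℝ b ((stereographic' d v).symm z : EuclideanSpace ℝ (Fin (d + 1))) := by
    intro z
    have hq := (sqNorm_add_four_pos z).ne'
    have hz : ∑ j, z j ^ 2 = sqNorm z := rfl
    simp only [stereoTractor, quadTractor]
    rw [stereographic_symm_eq, exp_roundFactor, ← inner_stereoFrame_right, hz]
    simp only [inner_add_right, inner_sub_right, real_inner_smul_right]
    field_simp
    ring
  have hψ : ∀ k, pderiv k roundFactor y = -(2 * y k) / (sqNorm y + 4) := by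
    intro k
    have hq := (sqNorm_add_four_pos y).ne'
    -- Differentiating the identity `(|y|² + 4) e^ψ = 4` avoids differentiating the logarithm.
    have h1 : pderiv k (fun z => (sqNorm z + 4) * Real.exp (roundFactor z)) y = 0 := by
      have : (fun z : EuclideanSpace ℝ (Fin d) => (sqNorm z + 4) * Real.exp (roundFactor z))
          = fun _ => 4 := by
        funext z
        rw [exp_roundFactor]
        field_simp [(sqNorm_add_four_pos z).ne']
      rw [this, pderiv_const]
    have d1 := contDiff_sqNorm.differentiable (by simp) y
    have d2 := contDiff_roundFactor.differentiable (by simp) y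
    rw [pderiv_mul k (d1.add_const 4) d2.exp, pderiv_exp k d2,
      pderiv_add k d1 (differentiableAt_const _), pderiv_const, pderiv_sqNorm, exp_roundFactor] at h1
    field_simp at h1 ⊢
    linarith
  refine Prod.ext (hfst y) (Prod.ext (funext fun j => ?_) ?_)
  · have d1 := contDiff_roundFactor.differentiable (by simp) y
    have d2 := (smooth_quadTractor (c - inner ℝ b (v : EuclideanSpace ℝ (Fin (d + 1))))
      (fun j => inner ℝ b (stereoFrame v (stdVec d j))) (-(c + inner ℝ b
        (v : EuclideanSpace ℝ (Fin (d + 1)))) / 2)).fst.differentiable (by simp) y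
    have d3 : DifferentiableAt ℝ (fun z => inner ℝ b
        ((stereographic' d v).symm z : EuclideanSpace ℝ (Fin (d + 1)))) y :=
      (contDiff_const.inner ℝ (contDiff_stereographic_symm v)).differentiable (n := ∞) (by simp) y
    have h1 : pderiv j (fun z => Real.exp (roundFactor z) * (stereoTractor v c b z).1) y
        = inner ℝ b (stereoVec v y j) := by
      simp only [hfst]
      rw [pderiv_add j (differentiableAt_const _) d3, pderiv_const, pderiv_inner_stereographic, zero_add]
    refine Eq.trans ?_ h1
    simp only [stereoTractor]
    rw [pderiv_mul j d1.exp d2, pderiv_exp j d1, pderiv_quadTractor_fst]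
    simp only [tractorGauge, quadTractor]
    ring
  · have hq := (sqNorm_add_four_pos y).ne'
    have hy : ∑ j, y j ^ 2 = sqNorm y := rfl
    have s1 : ∑ k, pderiv k roundFactor y * (stereoTractor v c b y).2.1 k
        = -2 / (sqNorm y + 4) * (∑ j, inner ℝ b (stereoFrame v (stdVec d j)) * y j
          + (c + inner ℝ b (v : EuclideanSpace ℝ (Fin (d + 1)))) / 2 * sqNorm y) := by
      rw [← hy, Finset.mul_sum, ← Finset.sum_add_distrib, Finset.mul_sum]
      refine Finset.sum_congr rfl fun k _ => ?_
      rw [hψ]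
      simp only [stereoTractor, quadTractor, hy]
      ring
    have s2 : ∑ k, pderiv k roundFactor y ^ 2 = 4 * sqNorm y / (sqNorm y + 4) ^ 2 := by
      nth_rewrite 1 [← hy]
      rw [Finset.mul_sum, Finset.sum_div]
      refine Finset.sum_congr rfl fun k _ => ?_
      rw [hψ, div_pow]
      ring
    simp only [tractorGauge]
    rw [s1, s2, Real.exp_neg, exp_roundFactor, stereographic_symm_eq]
    simp only [stereoTractor, quadTractor, inner_add_right, inner_sub_right, real_inner_smul_right,
      hy, inner_stereoFrame_right v b y]
    field_simp
    ring

/-- The function `e^φ (c + ⟨b, x⟩)` on the sphere. -/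
noncomputable def einsteinScale (φ : SmoothFn d (USphere d)) (c : ℝ)
    (b : EuclideanSpace ℝ (Fin (d + 1))) : SmoothFn d (USphere d) :=
  ⟨fun x => Real.exp (φ x) * (c + inner ℝ b (x : EuclideanSpace ℝ (Fin (d + 1)))), by
    have h1 : ContMDiff (𝓡 d) 𝓘(ℝ, EuclideanSpace ℝ (Fin (d + 1))) ∞
      (fun x : USphere d => (x : EuclideanSpace ℝ (Fin (d + 1)))) := contMDiff_coe_sphere
    have h2 : ContDiff ℝ ∞ fun p : ℝ × EuclideanSpace ℝ (Fin (d + 1)) =>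
        Real.exp p.1 * (c + inner ℝ b p.2) :=
      contDiff_fst.exp.mul (contDiff_const.add (contDiff_const.inner ℝ contDiff_snd))
    exact h2.contMDiff.comp (φ.contMDiff.prodMk_space h1)⟩

/-- The third component, in the scale `e^{2φ} g₀`, of the tractor with `σ = c + ⟨b, x⟩`. -/
noncomputable def einsteinBottom (φ : SmoothFn d (USphere d)) (c : ℝ)
    (b : EuclideanSpace ℝ (Fin (d + 1))) : SmoothFn d (USphere d) :=
  ⟨fun x => Real.exp (-φ x) * ((inner ℝ b (x : EuclideanSpace ℝ (Fin (d + 1))) - c) / 2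
      - inner ℝ b (sphereGrad φ x)
      - (1 / 2) * (c + inner ℝ b (x : EuclideanSpace ℝ (Fin (d + 1))))
        * inner ℝ (sphereGrad φ x) (sphereGrad φ x)), by
    have h1 : ContMDiff (𝓡 d) 𝓘(ℝ, EuclideanSpace ℝ (Fin (d + 1))) ∞
      (fun x : USphere d => (x : EuclideanSpace ℝ (Fin (d + 1)))) := contMDiff_coe_sphere
    have h2 : ContDiff ℝ ∞ fun p : (ℝ × EuclideanSpace ℝ (Fin (d + 1))) × EuclideanSpace ℝ (Fin (d + 1)) =>
        Real.exp (-p.1.1) * ((inner ℝ b p.1.2 - c) / 2 - inner ℝ b p.2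
          - (1 / 2) * (c + inner ℝ b p.1.2) * inner ℝ p.2 p.2) := by
      have h3 : ContDiff ℝ ∞ fun p : (ℝ × EuclideanSpace ℝ (Fin (d + 1))) ×
          EuclideanSpace ℝ (Fin (d + 1)) => inner ℝ b p.1.2 := contDiff_const.inner ℝ contDiff_fst.snd
      have h4 : ContDiff ℝ ∞ fun p : (ℝ × EuclideanSpace ℝ (Fin (d + 1))) ×
          EuclideanSpace ℝ (Fin (d + 1)) => inner ℝ b p.2 := contDiff_const.inner ℝ contDiff_snd
      exact contDiff_fst.fst.neg.exp.mul ((((h3.sub contDiff_const).div_const 2).sub h4).sub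
        ((contDiff_const.mul (contDiff_const.add h3)).mul (contDiff_snd.inner ℝ contDiff_snd)))
    exact h2.contMDiff.comp ((φ.contMDiff.prodMk_space h1).prodMk_space (contMDiff_sphereGrad φ))⟩

/-- The components, in the scale `e^{2φ} g₀`, of the tractor with `σ = c + ⟨b, x⟩`. -/
noncomputable def einsteinTriple (φ : SmoothFn d (USphere d)) (c : ℝ)
    (b : EuclideanSpace ℝ (Fin (d + 1))) :
    SmoothFn d (USphere d) × OneForm d (USphere d) × SmoothFn d (USphere d) :=
  (einsteinScale φ c b, differential (einsteinScale φ c b), einsteinBottom φ c b)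

theorem tractorCoord_einsteinTriple (φ : SmoothFn d (USphere d)) (c : ℝ)
    (b : EuclideanSpace ℝ (Fin (d + 1))) (v : USphere d) :
    tractorCoord (stereographic' d v) (einsteinTriple φ c b) =
      tractorGauge (fun y => roundFactor y + fnCoord (stereographic' d v) φ y) (stereoTractor v c b) := by
  have he := mem_atlas_sphere.2 ⟨v, rfl⟩
  have sφ := contDiff_fnCoord he (stereographic'_target v) φ
  funext y
  have dφ := sφ.differentiable (by simp) y
  rw [(conformallyFlatIn_round v).tractorGauge_add _ dφ, gauge_stereoTractor]
  refine Prod.ext rfl (Prod.ext (funext fun j => ?_) ?_)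
  · have d3 : DifferentiableAt ℝ (fun z => inner ℝ b
        ((stereographic' d v).symm z : EuclideanSpace ℝ (Fin (d + 1)))) y :=
      (contDiff_const.inner ℝ (contDiff_stereographic_symm v)).differentiable (n := ∞) (by simp) y
    have h1 : (tractorCoord (stereographic' d v) (einsteinTriple φ c b) y).2.1 j
        = pderiv j (fun z => Real.exp (fnCoord (stereographic' d v) φ z) *
          (c + inner ℝ b ((stereographic' d v).symm z : EuclideanSpace ℝ (Fin (d + 1))))) y :=
      formCoord_differential he (by simp) (einsteinScale φ c b) j
    rw [h1, pderiv_mul j dφ.exp (d3.const_add c), pderiv_exp j dφ,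
      pderiv_add j (differentiableAt_const _) d3, pderiv_const, pderiv_inner_stereographic]
    ring
  · simp only [← inner_stereoGrad_right, ← inner_stereoGrad_self, ← sphereGrad_symm]
    rfl

/-- Comparing one diagonal metric coefficient determines the factor; this needs a coordinate
direction, hence `d ≠ 0`. In particular the choice made in `logFactor` is harmless. -/
theorem rescaling_trans (hd : d ≠ 0) {g g' : SmoothMetric d (USphere d)}
    {φ φ' χ : SmoothFn d (USphere d)}
    (h : IsRescaling (roundMetric d) g φ) (h' : IsRescaling (roundMetric d) g' φ')
    (hχ : IsRescaling g g' χ) (x : USphere d) : φ' x = φ x + χ x := by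
  obtain ⟨v, y, rfl⟩ := exists_stereographic_symm_eq x
  let i : Fin d := ⟨0, Nat.pos_of_ne_zero hd⟩
  have h1 := (conformallyFlatIn_of_rescaling v h).gCoord_apply y i i
  have h2 := (conformallyFlatIn_of_rescaling v h').gCoord_apply y i i
  have h3 : gCoord g' (stereographic' d v) y i i
      = Real.exp (2 * χ ((stereographic' d v).symm y)) * gCoord g (stereographic' d v) y i i := hχ _ _ _
  rw [h1, h2, if_pos rfl, if_pos rfl, ← Real.exp_add, Real.exp_eq_exp] at h3
  simp only [fnCoord] at h3
  linarith

/-- The logarithm `φ` of the conformal factor of `g = e^{2φ} g₀`. -/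
noncomputable def logFactor (g : sphereConformal d) : SmoothFn d (USphere d) := g.2.choose

theorem logFactor_spec (g : sphereConformal d) :
    IsRescaling (roundMetric d) (g : SmoothMetric d (USphere d)) (logFactor g) := g.2.choose_spec

theorem conformallyFlatIn_sphereConformal (g : sphereConformal d) (v : USphere d) :
    ConformallyFlatIn (g : SmoothMetric d (USphere d)) (stereographic' d v)
      (fun y => roundFactor y + fnCoord (stereographic' d v) (logFactor g) y) :=
  conformallyFlatIn_of_rescaling v (logFactor_spec g)

/-- The parallel tractor with `σ = c + ⟨b, x⟩` in the scale of the round metric. -/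
noncomputable def einsteinTractor (hd : d ≠ 0) (c : ℝ) (b : EuclideanSpace ℝ (Fin (d + 1))) :
    tractors (sphereConformal d) :=
  ⟨fun g => einsteinTriple (logFactor g) c b, fun g g' χ h => by
    have hadd := rescaling_trans hd (logFactor_spec g) (logFactor_spec g') h
    refine ⟨fun x => ?_, fun e he y _ => ?_⟩
    · change Real.exp (logFactor g' x) * _ = Real.exp (χ x) * (Real.exp (logFactor g x) * _)
      rw [hadd, Real.exp_add]
      ring
    · obtain ⟨v, rfl⟩ := mem_atlas_sphere.1 he
      have dχ := (contDiff_fnCoord he (stereographic'_target v) χ).differentiable (by simp) y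
      -- The conformal exponents add, so the transformation law of the triple is the composition law
      -- `tractorGauge_add`.
      have hf : (fun z => roundFactor z + fnCoord (stereographic' d v) (logFactor g') z)
          = fun z => (roundFactor z + fnCoord (stereographic' d v) (logFactor g) z)
            + fnCoord (stereographic' d v) χ z := by
        funext z
        simp only [fnCoord, hadd]
        ring
      have key := congrFun (tractorCoord_einsteinTriple (logFactor g') c b v) y
      rw [hf, (conformallyFlatIn_sphereConformal g v).tractorGauge_add _ dχ,
        ← tractorCoord_einsteinTriple] at key
      exact ⟨fun j => congrArg (fun t => t.2.1 j) key, congrArg (fun t => t.2.2) key⟩⟩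

theorem tractorCoord_einsteinTractor (hd : d ≠ 0) (c : ℝ) (b : EuclideanSpace ℝ (Fin (d + 1)))
    (g : sphereConformal d) (v : USphere d) :
    tractorCoord (stereographic' d v) ((einsteinTractor hd c b).1 g) =
      tractorGauge (fun y => roundFactor y + fnCoord (stereographic' d v) (logFactor g) y)
        (stereoTractor v c b) :=
  tractorCoord_einsteinTriple (logFactor g) c b v

theorem isParallel_einsteinTractor (hd : 3 ≤ d) (c : ℝ) (b : EuclideanSpace ℝ (Fin (d + 1))) :
    IsParallelTractor (sphereConformal d) (einsteinTractor (by omega) c b) := by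
  intro g e he y _ i
  obtain ⟨v, rfl⟩ := mem_atlas_sphere.1 he
  rw [tractorCoord_einsteinTractor, stereoTractor,
    (conformallyFlatIn_sphereConformal g v).tractorDeriv_gauge_quadTractor hd]
  rfl

theorem exists_stereoFrame_eq (v : USphere d) {b : EuclideanSpace ℝ (Fin (d + 1))}
    (hb : inner ℝ b (v : EuclideanSpace ℝ (Fin (d + 1))) = 0) : ∃ w, stereoFrame v w = b := by
  have hb' : b ∈ (Submodule.span ℝ {(v : EuclideanSpace ℝ (Fin (d + 1)))})ᗮ :=
    Submodule.mem_orthogonal_singleton_iff_inner_left.2 hb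
  refine ⟨(OrthonormalBasis.fromOrthogonalSpanSingleton (𝕜 := ℝ) d
    (ne_zero_of_mem_unit_sphere v)).repr ⟨b, hb'⟩, ?_⟩
  simp [stereoFrame]

theorem inner_stereoFrame_stdVec (v : USphere d) (w : EuclideanSpace ℝ (Fin d)) (j : Fin d) :
    inner ℝ (stereoFrame v w) (stereoFrame v (stdVec d j)) = w j := by
  rw [LinearIsometry.inner_map_map]
  simp [stdVec, EuclideanSpace.inner_single_right]

/-- The orthogonal decomposition along `v` and `v^⊥`; the frame maps onto `v^⊥`. It recovers `b`
from the coefficients that appear in `stereoTractor`. -/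
theorem eq_add_stereoFrame (v : USphere d) (b : EuclideanSpace ℝ (Fin (d + 1))) :
    b = inner ℝ b (v : EuclideanSpace ℝ (Fin (d + 1))) • (v : EuclideanSpace ℝ (Fin (d + 1)))
      + stereoFrame v (WithLp.toLp 2 fun j => inner ℝ b (stereoFrame v (stdVec d j))) := by
  set s := inner ℝ b (v : EuclideanSpace ℝ (Fin (d + 1))) with hs
  obtain ⟨w, hw⟩ := exists_stereoFrame_eq v (b := b - s • (v : EuclideanSpace ℝ (Fin (d + 1)))) (by
    rw [inner_sub_left, real_inner_smul_left, inner_self_sphere, ← hs]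
    ring)
  have hwj : ∀ j, w j = inner ℝ b (stereoFrame v (stdVec d j)) := fun j => by
    rw [← inner_stereoFrame_stdVec v w j, hw, inner_sub_left, real_inner_smul_left,
      inner_stereoFrame_left]
    ring
  have hw' : (WithLp.toLp 2 fun j => inner ℝ b (stereoFrame v (stdVec d j))) = w := by
    ext j
    exact (hwj j).symm
  rw [hw', hw]
  module

theorem inner_self_eq_stereoFrame (v : USphere d) (b : EuclideanSpace ℝ (Fin (d + 1))) :
    inner ℝ b b = inner ℝ b (v : EuclideanSpace ℝ (Fin (d + 1))) ^ 2
      + ∑ j, inner ℝ b (stereoFrame v (stdVec d j)) ^ 2 := by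
  have h := congrArg (inner ℝ b) (eq_add_stereoFrame v b)
  rw [inner_add_right, real_inner_smul_right, inner_stereoFrame_right] at h
  simp only [pow_two]
  exact h

theorem stereoTractor_inj {v : USphere d} {c c' : ℝ} {b b' : EuclideanSpace ℝ (Fin (d + 1))}
    {y : EuclideanSpace ℝ (Fin d)} (h : stereoTractor v c b y = stereoTractor v c' b' y) :
    c = c' ∧ b = b' := by
  obtain ⟨h1, h2, h3⟩ := quadTractor_inj h
  refine ⟨by linarith, ?_⟩
  have h4 : inner ℝ b (v : EuclideanSpace ℝ (Fin (d + 1))) = inner ℝ b' (v : EuclideanSpace ℝ (Fin (d + 1))) := by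
    linarith
  rw [eq_add_stereoFrame v b, eq_add_stereoFrame v b', h2, h4]

theorem exists_stereoTractor_eq (v : USphere d) (a : ℝ) (β : Fin d → ℝ) (ρ : ℝ) :
    ∃ (c : ℝ) (b : EuclideanSpace ℝ (Fin (d + 1))), stereoTractor v c b = quadTractor a β ρ := by
  -- The solution of `c - ⟨b, v⟩ = a` and `-(c + ⟨b, v⟩)/2 = ρ`, with the component of `b` in `v^⊥`
  -- prescribed by `β`.
  refine ⟨a / 2 - ρ, stereoFrame v (WithLp.toLp 2 β) - (ρ + a / 2) • (v : EuclideanSpace ℝ (Fin (d + 1))), ?_⟩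
  have h1 : inner ℝ (stereoFrame v (WithLp.toLp 2 β) - (ρ + a / 2) • (v : EuclideanSpace ℝ (Fin (d + 1))))
      (v : EuclideanSpace ℝ (Fin (d + 1))) = -(ρ + a / 2) := by
    rw [inner_sub_left, real_inner_smul_left, inner_self_sphere, real_inner_comm, inner_stereoFrame_left]
    ring
  have h2 : (fun j => inner ℝ (stereoFrame v (WithLp.toLp 2 β) -
      (ρ + a / 2) • (v : EuclideanSpace ℝ (Fin (d + 1)))) (stereoFrame v (stdVec d j))) = β := by
    funext j
    rw [inner_sub_left, real_inner_smul_left, inner_stereoFrame_left, inner_stereoFrame_stdVec]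
    ring
  rw [stereoTractor, h1, h2]
  congr 1 <;> ring

end EinsteinTractors

/-! ### Classification of solutions and of parallel tractors -/

section Classification

variable {d : ℕ}

/-- The round metric as an element of the standard conformal structure. -/
noncomputable def roundElement (d : ℕ) : sphereConformal d :=
  ⟨roundMetric d, 0, fun x v w => by simp⟩

/-- A connected space with more than one point has no isolated point. Connectedness fails for the
two-point sphere, which `d ≠ 0` excludes. -/
theorem dense_compl_singleton_sphere (hd : d ≠ 0) (v : USphere d) : Dense ({v}ᶜ : Set (USphere d)) := by
  have hr : 1 < Module.rank ℝ (EuclideanSpace ℝ (Fin (d + 1))) := by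
    rw [← Module.finrank_eq_rank, finrank_euclideanSpace_fin]
    exact_mod_cast Nat.succ_lt_succ (Nat.pos_of_ne_zero hd)
  have : ConnectedSpace (USphere d) :=
    Subtype.connectedSpace (isConnected_sphere hr 0 zero_le_one)
  have : Nontrivial (USphere d) := ⟨v, -v, ne_neg_of_mem_unit_sphere ℝ v⟩
  exact dense_compl_singleton v

/-- One chart in the round scale suffices: the equation is solved explicitly there, continuity
covers the missing pole, and the density law carries the equality to every other metric of the
class. -/
theorem exists_tractorScale_einsteinTractor_eq (hd : 3 ≤ d) {σ : densities (sphereConformal d) 1}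
    (hσ : SolvesAE (sphereConformal d) σ) :
    ∃ c b, tractorScale (sphereConformal d) (einsteinTractor (by omega) c b) = σ := by
  have hd0 : d ≠ 0 := by omega
  let v : USphere d := ⟨EuclideanSpace.single 0 1, by simp⟩
  have he := mem_atlas_sphere.2 ⟨v, rfl⟩
  obtain ⟨a, β, ρ, h⟩ := (conformallyFlatIn_sphereConformal (roundElement d) v).exists_quadTractor_of_aeTensor_eq_zero
    hd (contDiff_fnCoord he (stereographic'_target v) (σ.1 (roundElement d)))
    fun y i j => hσ (roundElement d) _ he y (by simp) i j
  obtain ⟨c, b, hcb⟩ := exists_stereoTractor_eq v a β ρ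
  refine ⟨c, b, ?_⟩
  set τ := tractorScale (sphereConformal d) (einsteinTractor hd0 c b) with hτ
  have h1 : ∀ y, σ.1 (roundElement d) ((stereographic' d v).symm y)
      = τ.1 (roundElement d) ((stereographic' d v).symm y) := by
    intro y
    have h2 := congrFun (tractorCoord_einsteinTractor hd0 c b (roundElement d) v) y
    rw [hcb] at h2
    exact (congrFun h y).trans (congrArg (fun t => t.1) h2).symm
  have h2 : (σ.1 (roundElement d) : USphere d → ℝ) = τ.1 (roundElement d) := by
    refine Continuous.ext_on (dense_compl_singleton_sphere hd0 v)
      (σ.1 (roundElement d)).contMDiff.continuous (τ.1 (roundElement d)).contMDiff.continuous ?_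
    intro x hx
    have := h1 (stereographic' d v x)
    rwa [(stereographic' d v).left_inv (by simpa using hx)] at this
  refine Subtype.ext (funext fun g => ContMDiffMap.ext fun x => ?_)
  rw [τ.2 (roundElement d) g (logFactor g) (logFactor_spec g) x,
    σ.2 (roundElement d) g (logFactor g) (logFactor_spec g) x, h2]

theorem solvesAE_of_isParallel (hd : d ≠ 0) {I : tractors (sphereConformal d)}
    (hI : IsParallelTractor (sphereConformal d) I) :
    SolvesAE (sphereConformal d) (tractorScale (sphereConformal d) I) := by
  intro g e he y _ i j
  obtain ⟨v, rfl⟩ := mem_atlas_sphere.1 he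
  exact (conformallyFlatIn_sphereConformal g v).aeTensor_of_parallel (t := I.1 g) hd
    (fun y i => hI g _ he y (by simp) i) y i j

/-- A parallel tractor is recovered from `σ`: the top slot gives `μ = dσ`, and a diagonal entry of
the middle slot gives `ρ`, because `g_{ii} > 0`. -/
theorem tractorScale_injOn_parallel (hd : d ≠ 0) {I J : tractors (sphereConformal d)}
    (hI : IsParallelTractor (sphereConformal d) I) (hJ : IsParallelTractor (sphereConformal d) J)
    (h : tractorScale (sphereConformal d) I = tractorScale (sphereConformal d) J) : I = J := by
  refine Subtype.ext (funext fun g => ?_)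
  have h1 : (I.1 g).1 = (J.1 g).1 := congrFun (congrArg Subtype.val h) g
  have pI := fun (v : USphere d) y i => hI g (stereographic' d v) (mem_atlas_sphere.2 ⟨v, rfl⟩) y (by simp) i
  have pJ := fun (v : USphere d) y i => hJ g (stereographic' d v) (mem_atlas_sphere.2 ⟨v, rfl⟩) y (by simp) i
  refine Prod.ext h1 (Prod.ext (oneForm_ext_formCoord fun v y j => ?_)
    (smoothFn_ext_fnCoord fun v y => ?_))
  · rw [formCoord_of_parallel (pI v), formCoord_of_parallel (pJ v), h1]
  · let i : Fin d := ⟨0, Nat.pos_of_ne_zero hd⟩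
    have h2 := hessian_of_parallel (pI v) y i i
    rw [h1, hessian_of_parallel (pJ v) y i i, (conformallyFlatIn_sphereConformal g v).gCoord_apply,
      if_pos rfl] at h2
    have := mul_right_cancel₀ (Real.exp_pos _).ne' h2
    linarith

/-- The top slot of `I` is an almost Einstein scale, hence that of some `einsteinTractor`, and
parallel tractors with equal top slots coincide. -/
theorem exists_eq_einsteinTractor (hd : 3 ≤ d) {I : tractors (sphereConformal d)}
    (hI : IsParallelTractor (sphereConformal d) I) :
    ∃ c b, I = einsteinTractor (by omega) c b := by
  have hd0 : d ≠ 0 := by omega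
  obtain ⟨c, b, h⟩ := exists_tractorScale_einsteinTractor_eq hd (solvesAE_of_isParallel hd0 hI)
  exact ⟨c, b, tractorScale_injOn_parallel hd0 hI (isParallel_einsteinTractor hd c b) h.symm⟩

theorem isParallel_zero : IsParallelTractor (sphereConformal d) 0 := by
  intro g e _ y _ i
  have h : tractorCoord e (((0 : tractors (sphereConformal d)).1 g)) = fun _ => 0 := rfl
  rw [h]
  refine Prod.ext ?_ (Prod.ext (funext fun j => ?_) ?_) <;>
    simp [tractorDeriv, pderiv_const, coInner]

theorem einsteinTractor_inj (hd : d ≠ 0) {c c' : ℝ} {b b' : EuclideanSpace ℝ (Fin (d + 1))}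
    (h : einsteinTractor hd c b = einsteinTractor hd c' b') : c = c' ∧ b = b' := by
  let v : USphere d := ⟨EuclideanSpace.single 0 1, by simp⟩
  have h1 := tractorCoord_einsteinTractor hd c b (roundElement d) v
  rw [h, tractorCoord_einsteinTractor] at h1
  exact (stereoTractor_inj (tractorGauge_inj (congrFun h1 0))).imp Eq.symm Eq.symm

theorem tractorFlat_sphere (hd : 3 ≤ d) : TractorFlat (sphereConformal d) := by
  intro g hg e he t ht y _ i j
  obtain ⟨v, rfl⟩ := mem_atlas_sphere.1 he
  rw [stereographic'_target, contDiffOn_univ] at ht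
  have st : SmoothLocalTractor t :=
    ⟨ht.fst, fun j => contDiff_pi.1 ht.snd.fst j, ht.snd.snd⟩
  exact congrFun ((conformallyFlatIn_sphereConformal ⟨g, hg⟩ v).tractorDeriv_comm hd i j st) y

theorem tractorTrivial_sphere (hd : 3 ≤ d) : TractorTrivial (sphereConformal d) := by
  intro g p s₀ μ₀ r₀
  have hd0 : d ≠ 0 := by omega
  obtain ⟨v, y, rfl⟩ := exists_stereographic_symm_eq p
  set ψ := fun y => roundFactor y + fnCoord (stereographic' d v) (logFactor g) y
  let t : LocalTractor d := fun _ => (s₀, fun j => μ₀ (coordVec (stereographic' d v) y j), r₀)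
  -- The prescribed value is ungauged to the flat model, where some parallel section attains it at
  -- `y`. The constant local tractor `t` matters only through its value there.
  obtain ⟨a, β, ρ, hq⟩ := exists_quadTractor_eq y (tractorUngauge ψ t y)
  obtain ⟨c, b, hcb⟩ := exists_stereoTractor_eq v a β ρ
  have hval : tractorCoord (stereographic' d v) ((einsteinTractor hd0 c b).1 g) y = t y := by
    rw [tractorCoord_einsteinTractor, hcb, ← congrFun (tractorGauge_ungauge ψ t) y]
    simp only [tractorGauge, hq]
    rfl
  refine ⟨einsteinTractor hd0 c b, ⟨isParallel_einsteinTractor hd c b, congrArg (fun t => t.1) hval,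
    fun w => eq_of_eq_coordVec v y (fun j => congrArg (fun t => t.2.1 j) hval) w,
    congrArg (fun t => t.2.2) hval⟩, ?_⟩
  · rintro J ⟨hJ, h1, h2, h3⟩
    obtain ⟨c', b', rfl⟩ := exists_eq_einsteinTractor hd hJ
    have hval' : tractorCoord (stereographic' d v) ((einsteinTractor hd0 c' b').1 g) y = t y :=
      Prod.ext h1 (Prod.ext (funext fun j => h2 _) h3)
    rw [← hval, tractorCoord_einsteinTractor, tractorCoord_einsteinTractor] at hval'
    obtain ⟨rfl, rfl⟩ := stereoTractor_inj (tractorGauge_inj hval')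
    rfl

/-- The almost Einstein scales `c + ⟨b, x⟩`. -/
noncomputable def einsteinScales (hd : d ≠ 0) :
    ℝ × EuclideanSpace ℝ (Fin (d + 1)) →ₗ[ℝ] densities (sphereConformal d) 1 where
  toFun p := tractorScale (sphereConformal d) (einsteinTractor hd p.1 p.2)
  map_add' p q := by
    refine Subtype.ext (funext fun g => ContMDiffMap.ext fun x => ?_)
    change Real.exp (logFactor g x) * (p.1 + q.1 + inner ℝ (p.2 + q.2) _)
      = Real.exp (logFactor g x) * (p.1 + inner ℝ p.2 _) + Real.exp (logFactor g x) * (q.1 + inner ℝ q.2 _)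
    rw [inner_add_left]
    ring
  map_smul' r p := by
    refine Subtype.ext (funext fun g => ContMDiffMap.ext fun x => ?_)
    change Real.exp (logFactor g x) * (r * p.1 + inner ℝ (r • p.2) _)
      = r * (Real.exp (logFactor g x) * (p.1 + inner ℝ p.2 _))
    rw [real_inner_smul_left]
    ring

theorem einsteinScales_injective (hd : 3 ≤ d) :
    Function.Injective (einsteinScales (d := d) (by omega)) := by
  intro p q h
  obtain ⟨h1, h2⟩ := einsteinTractor_inj (by omega) (tractorScale_injOn_parallel (by omega)
    (isParallel_einsteinTractor hd p.1 p.2) (isParallel_einsteinTractor hd q.1 q.2) h)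
  exact Prod.ext h1 h2

theorem solvesAE_iff_mem_range (hd : 3 ≤ d) (σ : densities (sphereConformal d) 1) :
    SolvesAE (sphereConformal d) σ ↔ σ ∈ LinearMap.range (einsteinScales (d := d) (by omega)) := by
  constructor
  · intro h
    obtain ⟨c, b, hcb⟩ := exists_tractorScale_einsteinTractor_eq hd h
    exact ⟨(c, b), hcb⟩
  · rintro ⟨p, rfl⟩
    exact solvesAE_of_isParallel (by omega) (isParallel_einsteinTractor hd p.1 p.2)

theorem tractorScale_ne_zero (hd : d ≠ 0) {I : tractors (sphereConformal d)}
    (hI : IsParallelTractor (sphereConformal d) I) (h0 : I ≠ 0) :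
    tractorScale (sphereConformal d) I ≠ 0 := fun h =>
  h0 (tractorScale_injOn_parallel hd hI isParallel_zero h)

/-- Substituting the coefficients of `stereoTractor` into `-(2aρ + |β|²)` gives `(c - ⟨b, v⟩)(c +
⟨b, v⟩) - |β|²`, which is `c² - |b|²` by Pythagoras. -/
theorem hasScaleCurv_einsteinTractor (hd : 3 ≤ d) (c : ℝ) (b : EuclideanSpace ℝ (Fin (d + 1))) :
    HasScaleCurv (sphereConformal d)
      (tractorScale (sphereConformal d) (einsteinTractor (by omega) c b)) (c ^ 2 - inner ℝ b b) := by
  intro g e he y _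
  obtain ⟨v, rfl⟩ := mem_atlas_sphere.1 he
  refine ((conformallyFlatIn_sphereConformal g v).scaleCurv_quadTractor hd
    (tractorCoord_einsteinTractor (by omega) c b g v) y).trans ?_
  rw [inner_self_eq_stereoFrame v b]
  ring

end Classification

theorem mainTheorem12 (d : ℕ) (hd : 3 ≤ d) :
    TractorFlat (sphereConformal d) ∧
    TractorTrivial (sphereConformal d) ∧
    Set.BijOn (tractorScale (sphereConformal d))
      {I | IsParallelTractor (sphereConformal d) I ∧ I ≠ 0}
      {σ | IsDirectedAE (sphereConformal d) σ} ∧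
    (∃ W : Submodule ℝ (densities (sphereConformal d) 1),
      Module.finrank ℝ W = d + 2 ∧
      ∀ σ, IsDirectedAE (sphereConformal d) σ ↔ σ ∈ W ∧ σ ≠ 0) ∧
    ∀ S : ℝ, ∃ I : tractors (sphereConformal d),
      IsParallelTractor (sphereConformal d) I ∧ I ≠ 0 ∧
      IsDirectedAE (sphereConformal d) (tractorScale (sphereConformal d) I) ∧
      HasScaleCurv (sphereConformal d) (tractorScale (sphereConformal d) I) S := by
  have hd0 : d ≠ 0 := by omega
  refine ⟨tractorFlat_sphere hd, tractorTrivial_sphere hd, ⟨?_, ?_, ?_⟩, ?_, ?_⟩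
  · rintro I ⟨hI, h0⟩
    exact ⟨solvesAE_of_isParallel hd0 hI, tractorScale_ne_zero hd0 hI h0⟩
  · rintro I ⟨hI, _⟩ J ⟨hJ, _⟩ h
    exact tractorScale_injOn_parallel hd0 hI hJ h
  · rintro σ ⟨hσ, h0⟩
    obtain ⟨c, b, rfl⟩ := exists_tractorScale_einsteinTractor_eq hd hσ
    refine ⟨_, ⟨isParallel_einsteinTractor hd c b, fun h => h0 ?_⟩, rfl⟩
    rw [h]
    rfl
  · refine ⟨LinearMap.range (einsteinScales hd0), ?_, fun σ => ?_⟩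
    · rw [LinearMap.finrank_range_of_inj (einsteinScales_injective hd), Module.finrank_prod,
        Module.finrank_self, finrank_euclideanSpace_fin]
      ring
    · rw [IsDirectedAE, solvesAE_iff_mem_range hd]
  · intro S
    -- Any nonzero `b` with `S + |b|² ≥ 0` would do, with `c = √(S + |b|²)`. The length `|S| + 1`
    -- ensures both conditions for every `S`, including `S = 0`.
    set b : EuclideanSpace ℝ (Fin (d + 1)) := EuclideanSpace.single 0 (|S| + 1) with hb
    have hbb : inner ℝ b b = (|S| + 1) ^ 2 := by
      simp [hb, pow_two]
    have hS : 0 ≤ S + (|S| + 1) ^ 2 := by nlinarith [neg_abs_le S, abs_nonneg S]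
    have hI := isParallel_einsteinTractor hd (√(S + (|S| + 1) ^ 2)) b
    have hne : einsteinTractor hd0 (√(S + (|S| + 1) ^ 2)) b ≠ 0 := by
      intro h
      have h1 : einsteinScales hd0 (√(S + (|S| + 1) ^ 2), b) = 0 := by
        change tractorScale (sphereConformal d) (einsteinTractor hd0 _ _) = 0
        rw [h]
        rfl
      have h2 := (map_eq_zero_iff _ (einsteinScales_injective hd)).1 h1
      have h3 : b = 0 := congrArg Prod.snd h2
      rw [h3, inner_zero_left] at hbb
      have : 0 < (|S| + 1) ^ 2 := by positivity
      linarith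
    refine ⟨_, hI, hne, ⟨solvesAE_of_isParallel hd0 hI, tractorScale_ne_zero hd0 hI hne⟩, ?_⟩
    have := hasScaleCurv_einsteinTractor hd (√(S + (|S| + 1) ^ 2)) b
    rwa [Real.sq_sqrt hS, hbb, add_sub_cancel_right] at this
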